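/- All algebras are complex, associative and unital. Let $H$ be a Hopf algebra with invertible antipode $S$ (Sweedler notation $\Delta(h)=\sum h_1\otimes h_2$). Let $(\mathcal P,\Delta_{\mathcal P},H,B,\iota,(\chi_i,J_i)_{i\in I})$ be a locally trivial quantum principal fibre bundle: $I$ is finite, $\mathcal P$ is a right $H$-comodule algebra, $(J_i)_{i\in I}$ is a complete covering of the algebra $B$ by two-sided ideals, $B_i=B/J_i$ with projection $\pi_i:B\to B_i$, the homomorphisms $\chi_i:\mathcal P\to B_i\otimes H$ are surjective and $\iota:B\to\mathcal P$ is injective, $(\mathrm{id}\otimes\Delta)\circ\chi_i=(\chi_i\otimes\mathrm{id})\circ\Delta_{\mathcal P}$, $\chi_i(\iota(a))=\pi_i(a)\otimes 1$, $(\ker\chi_i)_{i\in I}$ is a complete covering of $\mathcal P$, and $\iota(B)=\{f\in\mathcal P:\Delta_{\mathcal P}(f)=f\otimes 1\}$. Here a family of ideals $(K_i)_{i\in I}$ of an algebra $A$ is a covering if $\bigcap_iK_i=0$; its covering completion $A_c$ is the algebra of all $(a_i)\in\prod_iA/K_i$ such that $a_i$ and $a_j$ have the same image in $A/(K_i+K_j)$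 for all $i,j$; it is complete if the embedding $A\to A_c$ is onto. Let differential calculi $\Gamma(B_i)$ over $B_i$ and a right covariant differential calculus $\Gamma(H)$ over $H$, with coaction $\Delta^\Gamma$, be given. Let $\Gamma(\mathcal P)$ and $\Gamma(B)$ be the differential calculi adapted to them: $\chi_i$ and $\pi_i$ extend to homomorphisms of differential algebras $\chi_{i_\Gamma}:\Gamma(\mathcal P)\to\Gamma(B_i)\hat\otimes\Gamma(H)$ (skew tensor product) and $\pi_{i_\Gamma}:\Gamma(B)\to\Gamma(B_i)$, and $\bigcap_i\ker\chi_{i_\Gamma}=0$, $\bigcap_i\ker\pi_{i_\Gamma}=0$. Let $\Gamma_c(\mathcal P)\subset\prod_i\Gamma(B_i)\hat\otimes\Gamma(H)$ and $\Gamma_c(B)\subset\prod_i\Gamma(B_i)$ be the covering completions with respect to these kernels, with the componentwise differential $d$ and grading, let $\chi_{i_{\Gamma_c}}$ be the $i$-th projection of $\Gamma_c(\mathcal P)$, let $\Delta^{\Gamma_c}$ be the coaction of $H$ on $\Gamma_c(\mathcal P)$ given by $\mathrm{id}\otimes\Delta^\Gamma$ in each component, written $\gamma\mapsto\sum\gamma_0\otimes\gamma_1$,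 and let $\iota_{\Gamma_c}:\Gamma_c(B)\to\Gamma_c(\mathcal P)$, $(\rho_i)\mapsto(\rho_i\hat\otimes 1)$. Put $\mathrm{hor}\,\Gamma_c(\mathcal P)=\{\gamma\in\Gamma_c(\mathcal P):\chi_{i_{\Gamma_c}}(\gamma)\in\Gamma(B_i)\hat\otimes H\ \forall i\}$. A left (resp. right) covariant derivative is a linear map $D:\mathrm{hor}\,\Gamma_c(\mathcal P)\to\mathrm{hor}\,\Gamma_c(\mathcal P)$ which raises degrees by one and satisfies $D(1)=0$, $(D\otimes\mathrm{id})\circ\Delta^{\Gamma_c}=\Delta^{\Gamma_c}\circ D$, $D(\ker\chi_{i_{\Gamma_c}}\cap\mathrm{hor}\,\Gamma_c(\mathcal P))\subset\ker\chi_{i_{\Gamma_c}}$ for all $i$, and, for $\alpha\in\mathrm{hor}\,\Gamma_c(\mathcal P)$ and $\rho\in\Gamma_c(B)$, $$D(\iota_{\Gamma_c}(\rho)\alpha)=(d\iota_{\Gamma_c}(\rho))\alpha+(-1)^n\iota_{\Gamma_c}(\rho)D(\alpha)\quad(\rho\text{ of degree }n)$$ $$\text{(resp. } D(\alpha\,\iota_{\Gamma_c}(\rho))=D(\alpha)\iota_{\Gamma_c}(\rho)+(-1)^n\alpha\,d\iota_{\Gamma_c}(\rho)\quad(\alpha\text{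 of degree }n)\text{)}.$$ A left (resp. right) pre-connection form is a linear map $\omega:H\to\Gamma^1_c(\mathcal P)$ with $\omega(1)=0$ and, for all $h\in H$ and $i\in I$, $$\Delta^{\Gamma_c}(\omega(h))=\sum\omega(h_2)\otimes S(h_1)h_3,\qquad(1-\mathrm{hor}_c)\chi_{i_{\Gamma_c}}(\omega(h))=-\sum1\hat\otimes S(h_1)dh_2$$ $$\text{(resp. }\Delta^{\Gamma_c}(\omega(h))=\sum\omega(h_2)\otimes h_3S^{-1}(h_1),\qquad(1-\mathrm{hor}_c)\chi_{i_{\Gamma_c}}(\omega(h))=-\sum1\hat\otimes(dh_2)S^{-1}(h_1)\text{)},$$ where $\mathrm{hor}_c$ is the projection of $(\Gamma^1(B_i)\hat\otimes H)\oplus(B_i\hat\otimes\Gamma^1(H))$ onto the first summand. Proposition. There is a bijection $D\leftrightarrow\omega$ between the left covariant derivatives and the left pre-connection forms such that $$D(\gamma)=d\gamma+(-1)^n\sum\gamma_0\,\omega(\gamma_1)\quad\text{for all }\gamma\in\mathrm{hor}\,\Gamma^n_c(\mathcal P),\ n\ge0,$$ and there is a bijection $D\leftrightarrow\omega$ between the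 right covariant derivatives and the right pre-connection forms such that $$D(\gamma)=d\gamma+\sum\omega(\gamma_1)\,\gamma_0\quad\text{for all }\gamma\in\mathrm{hor}\,\Gamma_c(\mathcal P).$$ -/

import Mathlib

open scoped TensorProduct

noncomputable section

namespace QPB

universe u v w

/-! ### Differential calculi -/

/-- A differential calculus over a complex algebra `A`: an `ℕ`-graded complex algebra `carrier`
whose degree zero part is (a copy, via `of`, of) `A`, with a graded derivation `d` of degree one and
square zero, generated as an algebra by `A` and `dA`. -/
structure DifferentialCalculus (A : Type u) [Ring A] [Algebra ℂ A] where
  carrier : Type v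
  [ring : Ring carrier]
  [algebra : Algebra ℂ carrier]
  gr : ℕ → Submodule ℂ carrier
  [graded : GradedAlgebra gr]
  of : A →ₐ[ℂ] carrier
  of_injective : Function.Injective of
  range_of : LinearMap.range of.toLinearMap = gr 0
  d : carrier →ₗ[ℂ] carrier
  d_mem : ∀ {n : ℕ} {x : carrier}, x ∈ gr n → d x ∈ gr (n + 1)
  leibniz : ∀ {n : ℕ} {x : carrier}, x ∈ gr n → ∀ y : carrier,
    d (x * y) = d x * y + (-1 : ℂ) ^ n • (x * d y)
  d_d : ∀ x : carrier, d (d x) = 0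
  generated : Algebra.adjoin ℂ (Set.range of ∪ Set.range fun a => d (of a)) = ⊤

attribute [instance] DifferentialCalculus.ring DifferentialCalculus.algebra
  DifferentialCalculus.graded

namespace DifferentialCalculus

variable {A : Type u} [Ring A] [Algebra ℂ A] (Γ : DifferentialCalculus.{u, v} A)

/-- The linear map with `x ↦ (-1)^n x` for `x` of degree `n`. -/
def parity : Γ.carrier →ₗ[ℂ] Γ.carrier :=
  DirectSum.toModule ℂ ℕ Γ.carrier (fun n => (-1 : ℂ) ^ n • (Γ.gr n).subtype) ∘ₗ
    (DirectSum.decomposeLinearEquiv Γ.gr).toLinearMap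

/-- The projection onto the degree zero component. -/
def projZero : Γ.carrier →ₗ[ℂ] Γ.carrier := GradedAlgebra.proj Γ.gr 0

lemma of_mem (a : A) : Γ.of a ∈ Γ.gr 0 := by
  rw [← Γ.range_of]; exact ⟨a, rfl⟩

lemma parity_of_mem {n : ℕ} {x : Γ.carrier} (hx : x ∈ Γ.gr n) :
    Γ.parity x = (-1 : ℂ) ^ n • x := by
  simp only [parity, LinearMap.comp_apply, LinearEquiv.coe_coe,
    DirectSum.decomposeLinearEquiv_apply]
  rw [DirectSum.decompose_of_mem _ hx, ← DirectSum.lof_eq_of ℂ, DirectSum.toModule_lof]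
  rfl

lemma d_one : Γ.d 1 = 0 := by
  have h := Γ.leibniz (n := 0) (x := 1) SetLike.GradedOne.one_mem 1
  simpa using h

end DifferentialCalculus

/-! ### The skew tensor product of two differential calculi -/

section Skew

variable {A : Type*} [Ring A] [Algebra ℂ A] {C : Type*} [Ring C] [Algebra ℂ C]
variable (Γ : DifferentialCalculus A) (Λ : DifferentialCalculus C)

/-- The algebra `Γ(A) ⊗̂ Γ(C)`, with `(γ ⊗ ρ)(ω ⊗ τ) = (-1)^(mn) γω ⊗ ρτ` for `ω` of degree `n` and
`ρ` of degree `m`. -/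
abbrev Skew : Type _ := GradedTensorProduct ℂ Γ.gr Λ.gr

/-- The linear identification of `Γ(A) ⊗ Γ(C)` with `Γ(A) ⊗̂ Γ(C)`. -/
abbrev skewEquiv : Γ.carrier ⊗[ℂ] Λ.carrier ≃ₗ[ℂ] Skew Γ Λ :=
  GradedTensorProduct.of ℂ Γ.gr Λ.gr

/-- The element `γ ⊗ ρ` of `Γ(A) ⊗̂ Γ(C)`. -/
abbrev skewTmul (x : Γ.carrier) (y : Λ.carrier) : Skew Γ Λ := skewEquiv Γ Λ (x ⊗ₜ[ℂ] y)

/-- The differential `d(γ ⊗ ρ) = dγ ⊗ ρ + (-1)^n γ ⊗ dρ`, `γ` of degree `n`. -/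
def skewD : Skew Γ Λ →ₗ[ℂ] Skew Γ Λ :=
  (skewEquiv Γ Λ).toLinearMap ∘ₗ
    (TensorProduct.map Γ.d LinearMap.id + TensorProduct.map Γ.parity Λ.d) ∘ₗ
      (skewEquiv Γ Λ).symm.toLinearMap

/-- The part of total degree `n` of `Γ(A) ⊗̂ Γ(C)`. -/
def skewGr (n : ℕ) : Submodule ℂ (Skew Γ Λ) :=
  Submodule.span ℂ {z | ∃ p q : ℕ, p + q = n ∧ ∃ x ∈ Γ.gr p, ∃ y ∈ Λ.gr q, z = skewTmul Γ Λ x y}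

/-- The inclusion of `A ⊗ C` as the degree zero part of `Γ(A) ⊗̂ Γ(C)`. -/
def skewOf : A ⊗[ℂ] C →ₗ[ℂ] Skew Γ Λ :=
  (skewEquiv Γ Λ).toLinearMap ∘ₗ TensorProduct.map Γ.of.toLinearMap Λ.of.toLinearMap

/-- The canonical projection `hor_c` onto `Γ(A) ⊗̂ C` along `Γ(A) ⊗̂ Γ^k(C)`, `k ≥ 1`. In total degree
one, it is the projection of `(Γ¹(A) ⊗̂ C) ⊕ (A ⊗̂ Γ¹(C))` onto the first summand. -/
def horC : Skew Γ Λ →ₗ[ℂ] Skew Γ Λ :=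
  (skewEquiv Γ Λ).toLinearMap ∘ₗ TensorProduct.map LinearMap.id Λ.projZero ∘ₗ
    (skewEquiv Γ Λ).symm.toLinearMap

variable {Γ Λ}

lemma skewD_tmul (x : Γ.carrier) (y : Λ.carrier) :
    skewD Γ Λ (skewTmul Γ Λ x y) =
      skewTmul Γ Λ (Γ.d x) y + skewTmul Γ Λ (Γ.parity x) (Λ.d y) := by
  simp [skewD, skewTmul]

lemma skewTmul_mul {j i : ℕ} (a : Γ.carrier) {b : Λ.carrier} (hb : b ∈ Λ.gr j)
    {a' : Γ.carrier} (ha : a' ∈ Γ.gr i) (c : Λ.carrier) :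
    skewTmul Γ Λ a b * skewTmul Γ Λ a' c =
      (-1 : ℂ) ^ (j * i) • skewTmul Γ Λ (a * a') (b * c) := by
  have h := GradedTensorProduct.tmul_coe_mul_coe_tmul (R := ℂ) Γ.gr Λ.gr a ⟨b, hb⟩ ⟨a', ha⟩ c
  refine h.trans ?_
  rcases Nat.even_or_odd (j * i) with he | ho
  · simp [he.neg_one_pow]
  · simp [ho.neg_one_pow]

lemma skewTmul_of_mul (a : Γ.carrier) (h : C) (a' : Γ.carrier) (c : Λ.carrier) :
    skewTmul Γ Λ a (Λ.of h) * skewTmul Γ Λ a' c = skewTmul Γ Λ (a * a') (Λ.of h * c) := by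
  induction a' using DirectSum.Decomposition.inductionOn Γ.gr with
  | zero => simp [skewTmul]
  | homogeneous x => simpa using skewTmul_mul a (Λ.of_mem h) x.2 c
  | add x y hx hy =>
    simp only [skewTmul, TensorProduct.add_tmul, mul_add, map_add] at *
    rw [hx, hy]

lemma skewTmul_one_mul (a : Γ.carrier) (a' : Γ.carrier) (c : Λ.carrier) :
    skewTmul Γ Λ a 1 * skewTmul Γ Λ a' c = skewTmul Γ Λ (a * a') c := by
  simpa using skewTmul_of_mul (Λ := Λ) a 1 a' c

lemma skewTmul_add_left (a a' : Γ.carrier) (c : Λ.carrier) :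
    skewTmul Γ Λ (a + a') c = skewTmul Γ Λ a c + skewTmul Γ Λ a' c := by
  simp [skewTmul, TensorProduct.add_tmul]

variable (Γ Λ)

/-- The subalgebra `Γ(A) ⊗̂ C` of horizontal elements of `Γ(A) ⊗̂ Γ(C)`. -/
def horLoc : Subalgebra ℂ (Skew Γ Λ) where
  __ := LinearMap.range ((skewEquiv Γ Λ).toLinearMap ∘ₗ
    TensorProduct.map LinearMap.id Λ.of.toLinearMap : Γ.carrier ⊗[ℂ] C →ₗ[ℂ] Skew Γ Λ)
  mul_mem' := by
    rintro _ _ ⟨s, rfl⟩ ⟨t, rfl⟩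
    change _ ∈ LinearMap.range _
    induction s with
    | zero => simp
    | add s s' hs hs' => rw [map_add, add_mul]; exact add_mem hs hs'
    | tmul a h =>
      induction t with
      | zero => simp
      | add t t' ht ht' => rw [map_add, mul_add]; exact add_mem ht ht'
      | tmul a' h' =>
        refine ⟨(a * a') ⊗ₜ (h * h'), ?_⟩
        have := skewTmul_of_mul (Γ := Γ) (Λ := Λ) a h a' (Λ.of h')
        simpa using this.symm
  algebraMap_mem' r := by
    change _ ∈ LinearMap.range _
    refine ⟨algebraMap ℂ Γ.carrier r ⊗ₜ 1, ?_⟩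
    simp [GradedTensorProduct.algebraMap_def]

lemma mem_horLoc {x : Skew Γ Λ} : x ∈ horLoc Γ Λ ↔ ∃ t : Γ.carrier ⊗[ℂ] C,
    skewEquiv Γ Λ (TensorProduct.map LinearMap.id Λ.of.toLinearMap t) = x := Iff.rfl

end Skew

/-! ### Restricting a coaction to an invariant subspace -/

section Restrict

variable {V W H : Type*} [AddCommGroup V] [Module ℂ V] [AddCommGroup W] [Module ℂ W]
  [AddCommGroup H] [Module ℂ H]

/-- Slicing with a functional on the second factor. -/
def slice (V : Type*) [AddCommGroup V] [Module ℂ V] (φ : H →ₗ[ℂ] ℂ) : V ⊗[ℂ] H →ₗ[ℂ] V :=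
  (TensorProduct.rid ℂ V).toLinearMap ∘ₗ LinearMap.lTensor V φ

lemma slice_tmul (φ : H →ₗ[ℂ] ℂ) (v : V) (h : H) : slice V φ (v ⊗ₜ h) = φ h • v := by
  simp [slice]

lemma slice_rTensor (φ : H →ₗ[ℂ] ℂ) (f : V →ₗ[ℂ] W) (t : V ⊗[ℂ] H) :
    slice W φ (LinearMap.rTensor H f t) = f (slice V φ t) := by
  induction t with
  | zero => simp
  | add s t hs ht => simp only [map_add, hs, ht]
  | tmul v h => simp [slice_tmul]

lemma mem_range_of_slice (U : Submodule ℂ V) (t : V ⊗[ℂ] H)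
    (ht : ∀ φ : H →ₗ[ℂ] ℂ, slice V φ t ∈ U) :
    t ∈ LinearMap.range (LinearMap.rTensor H U.subtype) := by
  have hex : Function.Exact (LinearMap.rTensor H U.subtype) (LinearMap.rTensor H U.mkQ) :=
    rTensor_exact H (LinearMap.exact_subtype_mkQ U) U.mkQ_surjective
  refine (hex t).1 ?_
  classical
  let b := Module.Basis.ofVectorSpace ℂ H
  refine (TensorProduct.equivFinsuppOfBasisRight b).injective ?_
  rw [map_zero]
  ext i
  have key : ∀ s : (V ⧸ U) ⊗[ℂ] H,
      TensorProduct.equivFinsuppOfBasisRight b s i = slice _ (b.coord i) s := by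
    intro s
    induction s with
    | zero => simp
    | add s t hs ht => simp only [map_add, Finsupp.add_apply, hs, ht]
    | tmul v h => simp [slice_tmul]
  rw [key, slice_rTensor]
  simpa using ht (b.coord i)

lemma rTensor_subtype_injective (U : Submodule ℂ V) :
    Function.Injective (LinearMap.rTensor H U.subtype) :=
  Module.Flat.rTensor_preserves_injective_linearMap _ U.subtype_injective

/-- The restriction of a linear map `δ : V → V ⊗ H` to a subspace `U` with `δ(U) ⊆ U ⊗ H`. -/
def restrictCoaction (δ : V →ₗ[ℂ] V ⊗[ℂ] H) (U : Submodule ℂ V)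
    (hU : ∀ x ∈ U, δ x ∈ LinearMap.range (LinearMap.rTensor H U.subtype)) :
    U →ₗ[ℂ] U ⊗[ℂ] H :=
  (LinearEquiv.ofInjective _ (rTensor_subtype_injective U)).symm.toLinearMap ∘ₗ
    (δ ∘ₗ U.subtype).codRestrict _ fun x => hU x x.2

lemma rTensor_restrictCoaction (δ : V →ₗ[ℂ] V ⊗[ℂ] H) (U : Submodule ℂ V)
    (hU : ∀ x ∈ U, δ x ∈ LinearMap.range (LinearMap.rTensor H U.subtype)) (x : U) :
    LinearMap.rTensor H U.subtype (restrictCoaction δ U hU x) = δ x := by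
  have := LinearEquiv.apply_symm_apply
    (LinearEquiv.ofInjective _ (rTensor_subtype_injective (H := H) U))
    ((δ ∘ₗ U.subtype).codRestrict _ (fun x => hU x x.2) x)
  exact congrArg Subtype.val this

end Restrict

/-! ### Right covariant differential calculi over a Hopf algebra -/

/-- A right covariant differential calculus over the Hopf algebra `H`: a differential calculus
`Γ(H)` which is a right `H`-comodule algebra, with coaction
`h₀ dh₁ ⋯ dhₙ ↦ Δ(h₀) (d ⊗ id)Δ(h₁) ⋯ (d ⊗ id)Δ(hₙ)`. -/
structure RightCovariantCalculus (H : Type u) [Ring H] [HopfAlgebra ℂ H]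
    extends DifferentialCalculus.{u, v} H where
  coact : carrier →ₐ[ℂ] carrier ⊗[ℂ] H
  coact_of : ∀ h : H, coact (of h) =
    TensorProduct.map of.toLinearMap LinearMap.id (Coalgebra.comul (R := ℂ) h)
  coact_d_of : ∀ h : H, coact (d (of h)) =
    TensorProduct.map (d ∘ₗ of.toLinearMap) LinearMap.id (Coalgebra.comul (R := ℂ) h)
  coassoc : ∀ x : carrier,
    TensorProduct.assoc ℂ carrier H H (LinearMap.rTensor H coact.toLinearMap (coact x)) =
      LinearMap.lTensor carrier (Coalgebra.comul (R := ℂ)) (coact x)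
  coact_counit : ∀ x : carrier,
    TensorProduct.rid ℂ carrier
      (LinearMap.lTensor carrier (Coalgebra.counit (R := ℂ)) (coact x)) = x

section Hopf

variable (H : Type*) [Ring H] [HopfAlgebra ℂ H]

/-- The inverse of a bijective antipode. -/
def antipodeInv (hS : Function.Bijective (HopfAlgebra.antipode ℂ : H →ₗ[ℂ] H)) : H →ₗ[ℂ] H :=
  (LinearEquiv.ofBijective (HopfAlgebra.antipode ℂ : H →ₗ[ℂ] H) hS).symm.toLinearMap

/-- The iterated comultiplication with the first two legs interchanged,
`h ↦ ∑ h₂ ⊗ (h₁ ⊗ h₃)`. -/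
def comulSwap : H →ₗ[ℂ] H ⊗[ℂ] (H ⊗[ℂ] H) :=
  (TensorProduct.leftComm ℂ H H H).toLinearMap ∘ₗ
    LinearMap.lTensor H (Coalgebra.comul (R := ℂ)) ∘ₗ Coalgebra.comul (R := ℂ)

/-- The left adjoint coaction `h ↦ ∑ h₂ ⊗ S(h₁)h₃`. -/
def adL : H →ₗ[ℂ] H ⊗[ℂ] H :=
  LinearMap.lTensor H (LinearMap.mul' ℂ H ∘ₗ
    TensorProduct.map (HopfAlgebra.antipode ℂ) LinearMap.id) ∘ₗ comulSwap H

/-- The right adjoint coaction `h ↦ ∑ h₂ ⊗ h₃S⁻¹(h₁)`. -/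
def adR (hS : Function.Bijective (HopfAlgebra.antipode ℂ : H →ₗ[ℂ] H)) : H →ₗ[ℂ] H ⊗[ℂ] H :=
  LinearMap.lTensor H (LinearMap.mul' ℂ H ∘ₗ (TensorProduct.comm ℂ H H).toLinearMap ∘ₗ
    TensorProduct.map (antipodeInv H hS) LinearMap.id) ∘ₗ comulSwap H

variable {H}
variable (Λ : RightCovariantCalculus H)

/-- The map `h ↦ ∑ S(h₁)dh₂`. -/
def vertL : H →ₗ[ℂ] Λ.carrier :=
  LinearMap.mul' ℂ Λ.carrier ∘ₗ
    TensorProduct.map (Λ.of.toLinearMap ∘ₗ HopfAlgebra.antipode ℂ) (Λ.d ∘ₗ Λ.of.toLinearMap) ∘ₗ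
      Coalgebra.comul (R := ℂ)

/-- The map `h ↦ ∑ (dh₂)S⁻¹(h₁)`. -/
def vertR (hS : Function.Bijective (HopfAlgebra.antipode ℂ : H →ₗ[ℂ] H)) : H →ₗ[ℂ] Λ.carrier :=
  LinearMap.mul' ℂ Λ.carrier ∘ₗ (TensorProduct.comm ℂ Λ.carrier Λ.carrier).toLinearMap ∘ₗ
    TensorProduct.map (Λ.of.toLinearMap ∘ₗ antipodeInv H hS) (Λ.d ∘ₗ Λ.of.toLinearMap) ∘ₗ
      Coalgebra.comul (R := ℂ)

end Hopf

section Covariant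

variable {A : Type*} [Ring A] [Algebra ℂ A] {H : Type*} [Ring H] [HopfAlgebra ℂ H]
variable (Γ : DifferentialCalculus A) (Λ : RightCovariantCalculus H)

/-- The coaction `id ⊗ Δ^Γ` of `H` on `Γ(A) ⊗̂ Γ(H)`. -/
def coactLoc : Skew Γ Λ.toDifferentialCalculus →ₗ[ℂ] Skew Γ Λ.toDifferentialCalculus ⊗[ℂ] H :=
  LinearMap.rTensor H (skewEquiv Γ Λ.toDifferentialCalculus).toLinearMap ∘ₗ
    (TensorProduct.assoc ℂ Γ.carrier Λ.carrier H).symm.toLinearMap ∘ₗ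
      LinearMap.lTensor Γ.carrier Λ.coact.toLinearMap ∘ₗ
        (skewEquiv Γ Λ.toDifferentialCalculus).symm.toLinearMap

variable {Γ Λ}

/-- The map `ρ ⊗ h ↦ (a ⊗ ρ) ⊗ h`. -/
def leftInsert (a : Γ.carrier) :
    Λ.carrier ⊗[ℂ] H →ₗ[ℂ] Skew Γ Λ.toDifferentialCalculus ⊗[ℂ] H :=
  LinearMap.rTensor H ((skewEquiv Γ Λ.toDifferentialCalculus).toLinearMap ∘ₗ
    TensorProduct.mk ℂ Γ.carrier Λ.carrier a)

lemma leftInsert_tmul (a : Γ.carrier) (y : Λ.carrier) (h : H) :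
    leftInsert a (y ⊗ₜ[ℂ] h) = skewTmul Γ Λ.toDifferentialCalculus a y ⊗ₜ[ℂ] h := rfl

lemma coactLoc_tmul (a : Γ.carrier) (y : Λ.carrier) :
    coactLoc Γ Λ (skewTmul Γ Λ.toDifferentialCalculus a y) = leftInsert a (Λ.coact y) := by
  simp only [coactLoc, skewTmul, LinearMap.comp_apply, LinearEquiv.coe_coe,
    LinearEquiv.symm_apply_apply, LinearMap.lTensor_tmul, AlgHom.toLinearMap_apply]
  generalize Λ.coact y = t
  induction t with
  | zero => simp
  | tmul x h => rfl
  | add s t hs ht => simp only [TensorProduct.tmul_add, map_add, hs, ht]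

/-- The coaction preserves degrees. -/
lemma coact_mem {n : ℕ} {x : Λ.carrier} (hx : x ∈ Λ.gr n) :
    Λ.coact x ∈ LinearMap.range (LinearMap.rTensor H (Λ.gr n).subtype) := by
  let G : ℕ → Submodule ℂ Λ.carrier := fun n => Λ.gr n ⊓
    (LinearMap.range (LinearMap.rTensor H (Λ.gr n).subtype)).comap Λ.coact.toLinearMap
  have hof : ∀ h, Λ.of h ∈ G 0 := by
    refine fun h => ⟨Λ.of_mem h, ?_⟩
    change Λ.coact (Λ.of h) ∈ LinearMap.range (LinearMap.rTensor H (Λ.gr (0)).subtype)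
    rw [Λ.coact_of]
    generalize Coalgebra.comul (R := ℂ) h = t
    induction t with
    | zero => simp
    | tmul x y => exact ⟨⟨Λ.of x, Λ.of_mem x⟩ ⊗ₜ y, rfl⟩
    | add s t hs ht => rw [map_add]; exact add_mem hs ht
  have hd : ∀ h, Λ.d (Λ.of h) ∈ G 1 := by
    refine fun h => ⟨Λ.d_mem (Λ.of_mem h), ?_⟩
    change Λ.coact (Λ.d (Λ.of h)) ∈
      LinearMap.range (LinearMap.rTensor H (Λ.gr (1)).subtype)
    rw [Λ.coact_d_of]
    generalize Coalgebra.comul (R := ℂ) h = t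
    induction t with
    | zero => simp
    | tmul x y => exact ⟨⟨Λ.d (Λ.of x), Λ.d_mem (Λ.of_mem x)⟩ ⊗ₜ y, rfl⟩
    | add s t hs ht => rw [map_add]; exact add_mem hs ht
  have hmul : ∀ {m k : ℕ} {x y : Λ.carrier}, x ∈ G m → y ∈ G k → x * y ∈ G (m + k) := by
    rintro m k x y ⟨hx, hx'⟩ ⟨hy, hy'⟩
    refine ⟨SetLike.GradedMul.mul_mem hx hy, ?_⟩
    change Λ.coact (x * y) ∈ LinearMap.range (LinearMap.rTensor H (Λ.gr (m + k)).subtype)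
    change Λ.coact x ∈ LinearMap.range (LinearMap.rTensor H (Λ.gr (m)).subtype) at hx'
    change Λ.coact y ∈ LinearMap.range (LinearMap.rTensor H (Λ.gr (k)).subtype) at hy'
    rw [map_mul]
    obtain ⟨s, hs⟩ := hx'
    obtain ⟨t, ht⟩ := hy'
    rw [← hs, ← ht]
    clear hs ht
    induction s with
    | zero => simp
    | add s s' hs hs' => rw [map_add, add_mul]; exact add_mem hs hs'
    | tmul a h =>
      induction t with
      | zero => simp
      | add t t' ht ht' => rw [map_add, mul_add]; exact add_mem ht ht'
      | tmul a' h' =>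
        refine ⟨⟨a.1 * a'.1, SetLike.GradedMul.mul_mem a.2 a'.2⟩ ⊗ₜ (h * h'), ?_⟩
        simp only [LinearMap.rTensor_tmul, Submodule.subtype_apply,
          Algebra.TensorProduct.tmul_mul_tmul]
  have htop : ∀ x, x ∈ ⨆ n, G n := by
    intro x
    have hx : x ∈ Algebra.adjoin ℂ
        (Set.range Λ.of ∪ Set.range fun a => Λ.d (Λ.of a)) := by
      rw [Λ.generated]; trivial
    induction hx using Algebra.adjoin_induction with
    | mem x hx =>
      rcases hx with ⟨h, rfl⟩ | ⟨h, rfl⟩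
      · exact Submodule.mem_iSup_of_mem 0 (hof h)
      · exact Submodule.mem_iSup_of_mem 1 (hd h)
    | algebraMap r =>
      rw [← Λ.of.commutes r]
      exact Submodule.mem_iSup_of_mem 0 (hof _)
    | add x y _ _ hx hy => exact add_mem hx hy
    | mul x y hx0 hy0 hx hy =>
      clear hx0 hy0
      induction hx using Submodule.iSup_induction' with
      | zero => simp
      | add a b _ _ ha hb => rw [add_mul]; exact add_mem ha hb
      | mem m a ha =>
        induction hy using Submodule.iSup_induction' with
        | zero => simp
        | add c e _ _ hc he => rw [mul_add]; exact add_mem hc he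
        | mem k c hc => exact Submodule.mem_iSup_of_mem (m + k) (hmul ha hc)
  have hproj : ∀ y ∈ ⨆ n, G n, ∀ n, (DirectSum.decompose Λ.gr y n : Λ.carrier) ∈ G n := by
    intro y hy
    induction hy using Submodule.iSup_induction' with
    | zero => intro n; simp
    | add a b _ _ ha hb =>
      intro n
      rw [DirectSum.decompose_add, DirectSum.add_apply]
      exact add_mem (ha n) (hb n)
    | mem m a ha =>
      intro n
      by_cases h : m = n
      · subst h
        rw [DirectSum.decompose_of_mem_same _ ha.1]
        exact ha
      · rw [DirectSum.decompose_of_mem_ne _ ha.1 h]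
        exact zero_mem _
  have := hproj x (htop x) n
  rw [DirectSum.decompose_of_mem_same _ hx] at this
  exact this.2

lemma leftInsert_mul {j i : ℕ} (a : Γ.carrier) {a' : Γ.carrier} (ha : a' ∈ Γ.gr i)
    {u : Λ.carrier ⊗[ℂ] H} (hu : u ∈ LinearMap.range (LinearMap.rTensor H (Λ.gr j).subtype))
    (v : Λ.carrier ⊗[ℂ] H) :
    leftInsert a u * leftInsert a' v = (-1 : ℂ) ^ (j * i) • leftInsert (a * a') (u * v) := by
  obtain ⟨s, rfl⟩ := hu
  induction s with
  | zero => simp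
  | add s s' hs hs' => simp only [map_add, add_mul, hs, hs', smul_add]
  | tmul b h =>
    induction v with
    | zero => simp
    | add t t' ht ht' => simp only [map_add, mul_add, ht, ht', smul_add]
    | tmul c h' =>
      rw [LinearMap.rTensor_tmul, leftInsert_tmul, leftInsert_tmul,
        Algebra.TensorProduct.tmul_mul_tmul, Algebra.TensorProduct.tmul_mul_tmul, leftInsert_tmul,
        Submodule.subtype_apply, skewTmul_mul a b.2 ha c, TensorProduct.smul_tmul']

lemma skew_induction {motive : Skew Γ Λ.toDifferentialCalculus → Prop}
    (x : Skew Γ Λ.toDifferentialCalculus) (zero : motive 0)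
    (tmul : ∀ (i j : ℕ) (a : Γ.carrier) (b : Λ.carrier), a ∈ Γ.gr i → b ∈ Λ.gr j →
      motive (skewTmul Γ Λ.toDifferentialCalculus a b))
    (add : ∀ x y, motive x → motive y → motive (x + y)) : motive x := by
  obtain ⟨t, rfl⟩ := (skewEquiv Γ Λ.toDifferentialCalculus).surjective x
  induction t with
  | zero => simpa using zero
  | add s t hs ht => rw [map_add]; exact add _ _ hs ht
  | tmul a b =>
    induction a using DirectSum.Decomposition.inductionOn Γ.gr with
    | zero => simpa using zero
    | add a a' ha ha' => rw [TensorProduct.add_tmul, map_add]; exact add _ _ ha ha'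
    | @homogeneous i a =>
      induction b using DirectSum.Decomposition.inductionOn Λ.gr with
      | zero => simpa using zero
      | add b b' hb hb' => rw [TensorProduct.tmul_add, map_add]; exact add _ _ hb hb'
      | @homogeneous j b => exact tmul i j a b a.2 b.2

lemma coactLoc_mul (x y : Skew Γ Λ.toDifferentialCalculus) :
    coactLoc Γ Λ (x * y) = coactLoc Γ Λ x * coactLoc Γ Λ y := by
  induction x using skew_induction with
  | zero => simp
  | add x x' hx hx' => simp only [map_add, add_mul, hx, hx']
  | tmul _ j a b _ hb =>
    induction y using skew_induction with
    | zero => simp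
    | add y y' hy hy' => simp only [map_add, mul_add, hy, hy']
    | tmul i _ a' c ha _ =>
      rw [skewTmul_mul a hb ha, map_smul, coactLoc_tmul, coactLoc_tmul, coactLoc_tmul, map_mul,
        leftInsert_mul a ha (coact_mem hb)]

lemma coactLoc_algebraMap (r : ℂ) :
    coactLoc Γ Λ (algebraMap ℂ _ r) = algebraMap ℂ _ r := by
  have h : (algebraMap ℂ (Skew Γ Λ.toDifferentialCalculus) r) =
      skewTmul Γ Λ.toDifferentialCalculus (algebraMap ℂ _ r) 1 := rfl
  rw [h, coactLoc_tmul, map_one, Algebra.TensorProduct.one_def, leftInsert_tmul, ← h]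
  rfl

lemma coactLoc_skewOf (x : A ⊗[ℂ] H) :
    coactLoc Γ Λ (skewOf Γ Λ.toDifferentialCalculus x) =
      LinearMap.rTensor H (skewOf Γ Λ.toDifferentialCalculus)
        ((TensorProduct.assoc ℂ A H H).symm
          (LinearMap.lTensor A (Coalgebra.comul (R := ℂ)) x)) := by
  induction x with
  | zero => simp
  | add x y hx hy => simp only [map_add, hx, hy]
  | tmul a h =>
    change coactLoc Γ Λ (skewTmul Γ Λ.toDifferentialCalculus (Γ.of a) (Λ.of h)) = _
    rw [coactLoc_tmul, Λ.coact_of, LinearMap.lTensor_tmul]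
    generalize Coalgebra.comul (R := ℂ) h = t
    induction t with
    | zero => simp
    | tmul x h => rfl
    | add s t hs ht => simp only [TensorProduct.tmul_add, map_add, hs, ht]

lemma coactLoc_skewD_skewOf (x : A ⊗[ℂ] H) :
    coactLoc Γ Λ (skewD Γ Λ.toDifferentialCalculus (skewOf Γ Λ.toDifferentialCalculus x)) =
      LinearMap.rTensor H (skewD Γ Λ.toDifferentialCalculus)
        (coactLoc Γ Λ (skewOf Γ Λ.toDifferentialCalculus x)) := by
  induction x with
  | zero => simp
  | add x y hx hy => simp only [map_add, hx, hy]
  | tmul a h =>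
    change coactLoc Γ Λ (skewD _ _ (skewTmul Γ Λ.toDifferentialCalculus (Γ.of a) (Λ.of h))) =
      LinearMap.rTensor H _
        (coactLoc Γ Λ (skewTmul Γ Λ.toDifferentialCalculus (Γ.of a) (Λ.of h)))
    rw [skewD_tmul, map_add, coactLoc_tmul, coactLoc_tmul, coactLoc_tmul, Λ.coact_of,
      Λ.coact_d_of]
    generalize Coalgebra.comul (R := ℂ) h = t
    induction t with
    | zero => simp
    | tmul x h =>
      simp only [TensorProduct.map_tmul, leftInsert_tmul, LinearMap.id_apply,
        LinearMap.comp_apply, AlgHom.toLinearMap_apply, LinearMap.rTensor_tmul, skewD_tmul,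
        TensorProduct.add_tmul]
    | add s t hs ht =>
      simp only [map_add] at *
      rw [← hs, ← ht]
      abel

/-- The coaction on `Γ(A) ⊗̂ Γ(H)` preserves horizontal elements. -/
lemma coactLoc_horLoc {x : Skew Γ Λ.toDifferentialCalculus}
    (hx : x ∈ horLoc Γ Λ.toDifferentialCalculus) (φ : H →ₗ[ℂ] ℂ) :
    slice _ φ (coactLoc Γ Λ x) ∈
      horLoc Γ Λ.toDifferentialCalculus := by
  obtain ⟨t, rfl⟩ := (mem_horLoc _ _).1 hx
  clear hx
  induction t with
  | zero => simp
  | add s t hs ht => simp only [map_add]; exact add_mem hs ht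
  | tmul a h =>
    change slice _ φ (coactLoc Γ Λ
      (skewTmul Γ Λ.toDifferentialCalculus a (Λ.of h))) ∈ _
    rw [coactLoc_tmul, Λ.coact_of]
    generalize Coalgebra.comul (R := ℂ) h = t
    induction t with
    | zero => simp
    | add s t hs ht => simp only [map_add]; exact add_mem hs ht
    | tmul x h =>
      rw [TensorProduct.map_tmul, leftInsert_tmul, slice_tmul]
      exact Subalgebra.smul_mem _ ((mem_horLoc _ _).2 ⟨a ⊗ₜ x, rfl⟩) _

end Covariant

/-! ### Coverings -/

section Covering

variable {I : Type*} {A : Type*} [Ring A] [Algebra ℂ A]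
  {Q : I → Type*} [∀ i, Ring (Q i)] [∀ i, Algebra ℂ (Q i)]

/-- Let `p i : A → Q i` be surjective homomorphisms, so that `Q i ≅ A / ker (p i)`.
For `a ∈ Q i` and `b ∈ Q j`, this says that the images of `a` and `b` in
`A / (ker (p i) + ker (p j))` are equal. -/
def Compatible (p : ∀ i, A →ₐ[ℂ] Q i) (i j : I) (a : Q i) (b : Q j) : Prop :=
  ∃ x y : A, p i x = a ∧ p j y = b ∧ x - y ∈ RingHom.ker (p i) ⊔ RingHom.ker (p j)

lemma compatible_iff (p : ∀ i, A →ₐ[ℂ] Q i) (i j : I) (a : Q i) (b : Q j) :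
    Compatible p i j a b ↔ ∃ x, p i x = a ∧ p j x = b := by
  constructor
  · rintro ⟨x, y, rfl, rfl, h⟩
    obtain ⟨s, hs, t, ht, hst⟩ := Submodule.mem_sup.1 h
    rw [RingHom.mem_ker] at hs ht
    refine ⟨x - s, by simp [hs], ?_⟩
    have : x - s = y + t := by rw [sub_eq_iff_eq_add, add_assoc, add_comm t, hst]; abel
    rw [this, map_add, ht, add_zero]
  · rintro ⟨x, rfl, rfl⟩
    exact ⟨x, x, rfl, rfl, by simp⟩

/-- The covering completion of `A` with respect to the family of ideals `ker (p i)`, where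
`A / ker (p i)` is identified with `Q i` by means of the surjection `p i`. -/
def coveringCompletion (p : ∀ i, A →ₐ[ℂ] Q i) : Subalgebra ℂ (∀ i, Q i) where
  carrier := {a | ∀ i j, Compatible p i j (a i) (a j)}
  mul_mem' := by
    intro a b ha hb i j
    obtain ⟨x, hx, hx'⟩ := (compatible_iff _ _ _ _ _).1 (ha i j)
    obtain ⟨y, hy, hy'⟩ := (compatible_iff _ _ _ _ _).1 (hb i j)
    exact (compatible_iff _ _ _ _ _).2 ⟨x * y, by simp [hx, hy], by simp [hx', hy']⟩
  add_mem' := by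
    intro a b ha hb i j
    obtain ⟨x, hx, hx'⟩ := (compatible_iff _ _ _ _ _).1 (ha i j)
    obtain ⟨y, hy, hy'⟩ := (compatible_iff _ _ _ _ _).1 (hb i j)
    exact (compatible_iff _ _ _ _ _).2 ⟨x + y, by simp [hx, hy], by simp [hx', hy']⟩
  algebraMap_mem' r i j := (compatible_iff _ _ _ _ _).2
    ⟨algebraMap ℂ A r, by simp, by simp⟩

lemma mem_coveringCompletion (p : ∀ i, A →ₐ[ℂ] Q i) (a : ∀ i, Q i) :
    a ∈ coveringCompletion p ↔ ∀ i j, ∃ x, p i x = a i ∧ p j x = a j := by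
  refine forall_congr' fun i => forall_congr' fun j => ?_
  exact compatible_iff p i j (a i) (a j)

/-- The ideals `ker (p i)` form a covering of `A` (their intersection is zero). -/
def IsCovering (p : ∀ i, A →ₐ[ℂ] Q i) : Prop := ⨅ i, RingHom.ker (p i) = ⊥

/-- The ideals `ker (p i)` form a complete covering of `A`: they form a covering, and the canonical
embedding of `A` into the covering completion is onto. -/
def IsCompleteCovering (p : ∀ i, A →ₐ[ℂ] Q i) : Prop :=
  IsCovering p ∧ ∀ a ∈ coveringCompletion p, ∃ x : A, ∀ i, p i x = a i

end Covering

/-! ### Locally trivial quantum principal fibre bundles -/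

/-- A locally trivial quantum principal fibre bundle with total space `P`, base `B`, structure group
`H`, and a covering of the base indexed by `I`. -/
structure LocallyTrivialBundle (I : Type*) (P : Type*) (B : Type*) (H : Type*)
    [Ring P] [Algebra ℂ P] [Ring B] [Algebra ℂ B] [Ring H] [HopfAlgebra ℂ H] where
  /-- the right coaction on the total space -/
  coact : P →ₐ[ℂ] P ⊗[ℂ] H
  coassoc : ∀ x : P,
    TensorProduct.assoc ℂ P H H (LinearMap.rTensor H coact.toLinearMap (coact x)) =
      LinearMap.lTensor P (Coalgebra.comul (R := ℂ)) (coact x)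
  coact_counit : ∀ x : P,
    TensorProduct.rid ℂ P (LinearMap.lTensor P (Coalgebra.counit (R := ℂ)) (coact x)) = x
  /-- the covering of the base by two-sided ideals -/
  J : I → Ideal B
  [twoSided : ∀ i, (J i).IsTwoSided]
  complete_base : IsCompleteCovering fun i => Ideal.Quotient.mkₐ ℂ (J i)
  /-- the local trivializations -/
  χ : ∀ i, P →ₐ[ℂ] (B ⧸ J i) ⊗[ℂ] H
  χ_surjective : ∀ i, Function.Surjective (χ i)
  /-- the embedding of the base -/
  ι : B →ₐ[ℂ] P
  ι_injective : Function.Injective ι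
  χ_coact : ∀ i x, TensorProduct.assoc ℂ (B ⧸ J i) H H
      (LinearMap.rTensor H (χ i).toLinearMap (coact x)) =
    LinearMap.lTensor (B ⧸ J i) (Coalgebra.comul (R := ℂ)) (χ i x)
  χ_ι : ∀ i a, χ i (ι a) = Ideal.Quotient.mk (J i) a ⊗ₜ[ℂ] (1 : H)
  complete_total : IsCompleteCovering χ
  range_ι : Set.range ι = {f : P | coact f = f ⊗ₜ[ℂ] (1 : H)}

attribute [instance] LocallyTrivialBundle.twoSided

/-! ### Differential structures on a bundle -/

section Bundle

variable {I P B H : Type*} [Ring P] [Algebra ℂ P] [Ring B] [Algebra ℂ B] [Ring H] [HopfAlgebra ℂ H]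

universe v₁ v₂ v₃ v₄

/-- A differential structure on a locally trivial bundle: differential calculi `Γ(B_i)` over the
`B_i = B / J_i`, a right covariant differential calculus `Γ(H)`, and the differential calculi
`Γ(P)` and `Γ(B)` over `P` and `B` which are adapted to the coverings: the maps
`χ_i : P → B_i ⊗ H` and `π_i : B → B_i` extend to homomorphisms
`Γ(P) → Γ(B_i) ⊗̂ Γ(H)` and `Γ(B) → Γ(B_i)` of differential algebras, and the kernels of the
extensions have intersection zero. -/
structure DifferentialStructure (E : LocallyTrivialBundle I P B H) where
  ΓB : ∀ i, DifferentialCalculus.{_, v₁} (B ⧸ E.J i)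
  ΓH : RightCovariantCalculus.{_, v₂} H
  ΓP : DifferentialCalculus.{_, v₃} P
  χΓ : ∀ i, ΓP.carrier →ₐ[ℂ] Skew (ΓB i) ΓH.toDifferentialCalculus
  χΓ_of : ∀ i x, χΓ i (ΓP.of x) = skewOf (ΓB i) ΓH.toDifferentialCalculus (E.χ i x)
  χΓ_mem : ∀ i n x, x ∈ ΓP.gr n → χΓ i x ∈ skewGr (ΓB i) ΓH.toDifferentialCalculus n
  χΓ_d : ∀ i x, χΓ i (ΓP.d x) = skewD (ΓB i) ΓH.toDifferentialCalculus (χΓ i x)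
  covering_total : IsCovering χΓ
  ΓBase : DifferentialCalculus.{_, v₄} B
  πΓ : ∀ i, ΓBase.carrier →ₐ[ℂ] (ΓB i).carrier
  πΓ_of : ∀ i b, πΓ i (ΓBase.of b) = (ΓB i).of (Ideal.Quotient.mk (E.J i) b)
  πΓ_mem : ∀ i n x, x ∈ ΓBase.gr n → πΓ i x ∈ (ΓB i).gr n
  πΓ_d : ∀ i x, πΓ i (ΓBase.d x) = (ΓB i).d (πΓ i x)
  covering_base : IsCovering πΓ

namespace DifferentialStructure

variable {E : LocallyTrivialBundle I P B H} (S : DifferentialStructure E)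

/-- The local algebra `Γ(B_i) ⊗̂ Γ(H)`. -/
abbrev Loc (i : I) : Type _ := Skew (S.ΓB i) S.ΓH.toDifferentialCalculus

/-- The direct sum (product) of the local algebras, which contains the covering completion of
`Γ(P)`. -/
abbrev Tot : Type _ := ∀ i, S.Loc i

/-- The covering completion `Γ_c(P)`. The map `χ_i` on it is the `i`-th projection. -/
def gammaC : Subalgebra ℂ S.Tot := coveringCompletion S.χΓ

/-- The covering completion `Γ_c(B)`. -/
def gammaCBase : Subalgebra ℂ (∀ i, (S.ΓB i).carrier) := coveringCompletion S.πΓ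

/-- The algebra `hor Γ_c(P)` of horizontal forms. -/
def hor : Subalgebra ℂ S.Tot :=
  S.gammaC ⊓ Subalgebra.pi Set.univ fun i => horLoc (S.ΓB i) S.ΓH.toDifferentialCalculus

/-- The componentwise differential, whose restriction is the differential of `Γ_c(P)`. -/
def dTot : S.Tot →ₗ[ℂ] S.Tot :=
  LinearMap.pi fun i => skewD (S.ΓB i) S.ΓH.toDifferentialCalculus ∘ₗ LinearMap.proj i

/-- The componentwise differential, whose restriction is the differential of `Γ_c(B)`. -/
def dBase : (∀ i, (S.ΓB i).carrier) →ₗ[ℂ] ∀ i, (S.ΓB i).carrier :=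
  LinearMap.pi fun i => (S.ΓB i).d ∘ₗ LinearMap.proj i

/-- Forms of degree `n` in the direct sum of the local algebras. -/
def gradeTot (n : ℕ) : Submodule ℂ S.Tot :=
  Submodule.pi Set.univ fun i => skewGr (S.ΓB i) S.ΓH.toDifferentialCalculus n

/-- Forms of degree `n` in the direct sum of the `Γ(B_i)`. -/
def gradeBase (n : ℕ) : Submodule ℂ (∀ i, (S.ΓB i).carrier) :=
  Submodule.pi Set.univ fun i => (S.ΓB i).gr n

lemma dTot_mem {x : S.Tot} (hx : x ∈ S.gammaC) : S.dTot x ∈ S.gammaC := by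
  rw [gammaC, mem_coveringCompletion] at *
  intro i j
  obtain ⟨y, hi, hj⟩ := hx i j
  exact ⟨S.ΓP.d y, by simp [S.χΓ_d, hi, dTot], by simp [S.χΓ_d, hj, dTot]⟩

/-- Every form on the base defines a form on the total space. -/
lemma exists_pullback (x : S.ΓBase.carrier) : ∃ y : S.ΓP.carrier,
    ∀ i, S.χΓ i y = skewTmul (S.ΓB i) S.ΓH.toDifferentialCalculus (S.πΓ i x) 1 := by
  have hx : x ∈ Algebra.adjoin ℂ
      (Set.range S.ΓBase.of ∪ Set.range fun a => S.ΓBase.d (S.ΓBase.of a)) := by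
    rw [S.ΓBase.generated]; trivial
  induction hx using Algebra.adjoin_induction with
  | mem x hx =>
    have key : ∀ b i, S.χΓ i (S.ΓP.of (E.ι b)) =
        skewTmul (S.ΓB i) S.ΓH.toDifferentialCalculus (S.πΓ i (S.ΓBase.of b)) 1 := by
      intro b i
      rw [S.χΓ_of, E.χ_ι, S.πΓ_of]
      simp [skewOf, skewTmul]
    rcases hx with ⟨b, rfl⟩ | ⟨b, rfl⟩
    · exact ⟨_, key b⟩
    · refine ⟨S.ΓP.d (S.ΓP.of (E.ι b)), fun i => ?_⟩
      rw [S.χΓ_d, key, skewD_tmul, S.ΓH.d_one]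
      simp [S.πΓ_d, skewTmul]
  | algebraMap r =>
    exact ⟨algebraMap ℂ _ r, fun i => by simp [GradedTensorProduct.algebraMap_def]⟩
  | add x y _ _ hx hy =>
    obtain ⟨s, hs⟩ := hx
    obtain ⟨t, ht⟩ := hy
    exact ⟨s + t, fun i => by rw [map_add, hs, ht, map_add, skewTmul_add_left]⟩
  | mul x y _ _ hx hy =>
    obtain ⟨s, hs⟩ := hx
    obtain ⟨t, ht⟩ := hy
    exact ⟨s * t, fun i => by rw [map_mul, hs, ht, map_mul, skewTmul_one_mul]⟩

/-- The embedding of `Γ_c(B)` into `hor Γ_c(P)`, `(ρ_i) ↦ (ρ_i ⊗ 1)`. -/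
def iotaC (ρ : S.gammaCBase) : S.hor :=
  ⟨fun i => skewTmul (S.ΓB i) S.ΓH.toDifferentialCalculus (ρ.1 i) 1, by
    refine ⟨?_, fun i _ => ?_⟩
    · refine (mem_coveringCompletion _ _).2 fun i j => ?_
      obtain ⟨x, hi, hj⟩ := (mem_coveringCompletion _ _).1 ρ.2 i j
      obtain ⟨y, hy⟩ := S.exists_pullback x
      exact ⟨y, by rw [hy, hi], by rw [hy, hj]⟩
    · exact (mem_horLoc _ _).2 ⟨ρ.1 i ⊗ₜ 1, by simp [skewTmul]⟩⟩


lemma exists_coact (x : S.ΓP.carrier) : ∃ t : S.ΓP.carrier ⊗[ℂ] H, ∀ i,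
    LinearMap.rTensor H (S.χΓ i).toLinearMap t = coactLoc (S.ΓB i) S.ΓH (S.χΓ i x) := by
  have hx : x ∈ Algebra.adjoin ℂ
      (Set.range S.ΓP.of ∪ Set.range fun a => S.ΓP.d (S.ΓP.of a)) := by
    rw [S.ΓP.generated]; trivial
  have key : ∀ p i, LinearMap.rTensor H (S.χΓ i).toLinearMap
      (LinearMap.rTensor H S.ΓP.of.toLinearMap (E.coact p)) =
        coactLoc (S.ΓB i) S.ΓH (S.χΓ i (S.ΓP.of p)) := by
    intro p i
    rw [S.χΓ_of, coactLoc_skewOf, ← E.χ_coact, LinearEquiv.symm_apply_apply,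
      ← LinearMap.comp_apply, ← LinearMap.comp_apply, ← LinearMap.rTensor_comp,
      ← LinearMap.rTensor_comp]
    congr 2
    ext y
    simp [S.χΓ_of]
  induction hx using Algebra.adjoin_induction with
  | mem x hx =>
    rcases hx with ⟨p, rfl⟩ | ⟨p, rfl⟩
    · exact ⟨_, key p⟩
    · refine ⟨LinearMap.rTensor H S.ΓP.d
        (LinearMap.rTensor H S.ΓP.of.toLinearMap (E.coact p)), fun i => ?_⟩
      have h := coactLoc_skewD_skewOf (Γ := S.ΓB i) (Λ := S.ΓH) (E.χ i p)
      rw [← S.χΓ_of, ← key, ← S.χΓ_d] at h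
      rw [h, ← LinearMap.comp_apply, ← LinearMap.comp_apply (LinearMap.rTensor H (skewD _ _)),
        ← LinearMap.rTensor_comp, ← LinearMap.rTensor_comp]
      congr 2
      ext y
      simp [S.χΓ_d]
  | algebraMap r =>
    refine ⟨algebraMap ℂ _ r, fun i => ?_⟩
    rw [AlgHom.commutes, coactLoc_algebraMap]
    simp [Algebra.TensorProduct.algebraMap_apply]
  | add x y _ _ hx hy =>
    obtain ⟨s, hs⟩ := hx
    obtain ⟨t, ht⟩ := hy
    exact ⟨s + t, fun i => by rw [map_add, hs, ht, map_add, map_add]⟩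
  | mul x y _ _ hx hy =>
    obtain ⟨s, hs⟩ := hx
    obtain ⟨t, ht⟩ := hy
    refine ⟨s * t, fun i => ?_⟩
    refine (map_mul (Algebra.TensorProduct.map (S.χΓ i) (AlgHom.id ℂ H)) s t).trans ?_
    rw [map_mul (S.χΓ i), coactLoc_mul, ← hs, ← ht]
    rfl

section Coaction

variable [Fintype I] [DecidableEq I]

/-- The componentwise coaction of `H` on the direct sum of the local algebras. -/
def coactTot : S.Tot →ₗ[ℂ] S.Tot ⊗[ℂ] H :=
  ∑ i, LinearMap.rTensor H (LinearMap.single ℂ S.Loc i) ∘ₗ coactLoc (S.ΓB i) S.ΓH ∘ₗ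
    LinearMap.proj i

lemma rTensor_proj_coactTot (x : S.Tot) (i : I) :
    LinearMap.rTensor H (LinearMap.proj i : S.Tot →ₗ[ℂ] S.Loc i) (S.coactTot x) =
      coactLoc (S.ΓB i) S.ΓH (x i) := by
  simp only [coactTot, LinearMap.sum_apply, map_sum, LinearMap.comp_apply, LinearMap.proj_apply]
  rw [Finset.sum_eq_single i]
  · rw [← LinearMap.comp_apply, ← LinearMap.rTensor_comp, LinearMap.proj_comp_single_same,
      LinearMap.rTensor_id, LinearMap.id_apply]
  · intro j _ hj
    rw [← LinearMap.comp_apply, ← LinearMap.rTensor_comp,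
      LinearMap.proj_comp_single_ne ℂ S.Loc i j hj.symm, LinearMap.rTensor_zero,
      LinearMap.zero_apply]
  · simp

lemma slice_coactTot (x : S.Tot) (i : I) (φ : H →ₗ[ℂ] ℂ) :
    slice S.Tot φ (S.coactTot x) i = slice _ φ (coactLoc (S.ΓB i) S.ΓH (x i)) := by
  rw [← rTensor_proj_coactTot, slice_rTensor]
  rfl

lemma slice_mem_gammaC {x : S.Tot} (hx : x ∈ S.gammaC) (φ : H →ₗ[ℂ] ℂ) :
    slice S.Tot φ (S.coactTot x) ∈ S.gammaC := by
  rw [gammaC, mem_coveringCompletion] at *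
  intro i j
  obtain ⟨y, hi, hj⟩ := hx i j
  obtain ⟨t, ht⟩ := S.exists_coact y
  refine ⟨slice _ φ t, ?_, ?_⟩
  · rw [slice_coactTot, ← hi, ← ht, slice_rTensor]; rfl
  · rw [slice_coactTot, ← hj, ← ht, slice_rTensor]; rfl

lemma coactTot_mem_gammaC : ∀ x ∈ Subalgebra.toSubmodule S.gammaC, S.coactTot x ∈
    LinearMap.range (LinearMap.rTensor H (Subalgebra.toSubmodule S.gammaC).subtype) :=
  fun _ hx => mem_range_of_slice _ _ fun φ => S.slice_mem_gammaC hx φ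

lemma coactTot_mem_hor : ∀ x ∈ Subalgebra.toSubmodule S.hor, S.coactTot x ∈
    LinearMap.range (LinearMap.rTensor H (Subalgebra.toSubmodule S.hor).subtype) := by
  refine fun x hx => mem_range_of_slice _ _ fun φ => ⟨S.slice_mem_gammaC hx.1 φ, fun i _ => ?_⟩
  rw [slice_coactTot]
  exact coactLoc_horLoc (hx.2 i trivial) φ

/-- The coaction of `H` on `Γ_c(P)`. -/
def coactC : S.gammaC →ₗ[ℂ] S.gammaC ⊗[ℂ] H :=
  restrictCoaction S.coactTot (Subalgebra.toSubmodule S.gammaC) S.coactTot_mem_gammaC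

/-- The coaction of `H` on `hor Γ_c(P)`. -/
def coactHor : S.hor →ₗ[ℂ] S.hor ⊗[ℂ] H :=
  restrictCoaction S.coactTot (Subalgebra.toSubmodule S.hor) S.coactTot_mem_hor

/-- `coactC` is the coaction with `(χ_i ⊗ id) ∘ Δ = (id ⊗ Δ^Γ) ∘ χ_i` for all `i`. -/
lemma coactC_spec (x : S.gammaC) (i : I) :
    LinearMap.rTensor H (LinearMap.proj i ∘ₗ S.gammaC.val.toLinearMap : S.gammaC →ₗ[ℂ] S.Loc i)
      (S.coactC x) = coactLoc (S.ΓB i) S.ΓH (x.1 i) := by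
  have h := rTensor_restrictCoaction S.coactTot (Subalgebra.toSubmodule S.gammaC)
    S.coactTot_mem_gammaC x
  have h' := S.rTensor_proj_coactTot x.1 i
  rw [← h, ← LinearMap.comp_apply, ← LinearMap.rTensor_comp] at h'
  exact h'

/-- `coactHor` is the restriction of `coactC`. -/
lemma coactHor_spec (x : S.hor) (i : I) :
    LinearMap.rTensor H (LinearMap.proj i ∘ₗ S.hor.val.toLinearMap : S.hor →ₗ[ℂ] S.Loc i)
      (S.coactHor x) = coactLoc (S.ΓB i) S.ΓH (x.1 i) := by
  have h := rTensor_restrictCoaction S.coactTot (Subalgebra.toSubmodule S.hor)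
    S.coactTot_mem_hor x
  have h' := S.rTensor_proj_coactTot x.1 i
  rw [← h, ← LinearMap.comp_apply, ← LinearMap.rTensor_comp] at h'
  exact h'

/-! ### Covariant derivatives -/

/-- The conditions common to left and right covariant derivatives. -/
structure IsCovariantOperator (D : S.hor →ₗ[ℂ] S.hor) : Prop where
  degree : ∀ (n : ℕ) (γ : S.hor), γ.1 ∈ S.gradeTot n → (D γ).1 ∈ S.gradeTot (n + 1)
  map_one : D 1 = 0
  covariant : ∀ γ : S.hor, LinearMap.rTensor H D (S.coactHor γ) = S.coactHor (D γ)
  map_ker : ∀ (i : I) (γ : S.hor), γ.1 i = 0 → (D γ).1 i = 0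

/-- Left covariant derivatives. -/
structure IsLeftCovariantDerivative (D : S.hor →ₗ[ℂ] S.hor) : Prop
    extends S.IsCovariantOperator D where
  leibniz : ∀ (n : ℕ) (ρ : S.gammaCBase) (α : S.hor), ρ.1 ∈ S.gradeBase n →
    (D (S.iotaC ρ * α)).1 =
      S.dTot (S.iotaC ρ).1 * α.1 + (-1 : ℂ) ^ n • ((S.iotaC ρ).1 * (D α).1)

/-- Right covariant derivatives. -/
structure IsRightCovariantDerivative (D : S.hor →ₗ[ℂ] S.hor) : Prop
    extends S.IsCovariantOperator D where
  leibniz : ∀ (n : ℕ) (ρ : S.gammaCBase) (α : S.hor), α.1 ∈ S.gradeTot n →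
    (D (α * S.iotaC ρ)).1 =
      (D α).1 * (S.iotaC ρ).1 + (-1 : ℂ) ^ n • (α.1 * S.dTot (S.iotaC ρ).1)

/-! ### Pre-connection forms -/

/-- Left pre-connection forms. -/
structure IsLeftPreConnectionForm (ω : H →ₗ[ℂ] S.gammaC) : Prop where
  degree : ∀ h : H, (ω h).1 ∈ S.gradeTot 1
  map_one : ω 1 = 0
  covariant : ∀ h : H, S.coactC (ω h) = LinearMap.rTensor H ω (adL H h)
  vertical : ∀ (i : I) (h : H), (ω h).1 i - horC _ _ ((ω h).1 i) =
    -skewTmul (S.ΓB i) S.ΓH.toDifferentialCalculus 1 (vertL S.ΓH h)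

/-- Right pre-connection forms. -/
structure IsRightPreConnectionForm
    (hS : Function.Bijective (HopfAlgebra.antipode ℂ : H →ₗ[ℂ] H))
    (ω : H →ₗ[ℂ] S.gammaC) : Prop where
  degree : ∀ h : H, (ω h).1 ∈ S.gradeTot 1
  map_one : ω 1 = 0
  covariant : ∀ h : H, S.coactC (ω h) = LinearMap.rTensor H ω (adR H hS h)
  vertical : ∀ (i : I) (h : H), (ω h).1 i - horC _ _ ((ω h).1 i) =
    -skewTmul (S.ΓB i) S.ΓH.toDifferentialCalculus 1 (vertR S.ΓH hS h)

/-- `∑ γ₀ ω(γ₁)` for a horizontal form `γ`. -/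
def convL (ω : H →ₗ[ℂ] S.gammaC) : S.hor →ₗ[ℂ] S.Tot :=
  LinearMap.mul' ℂ S.Tot ∘ₗ
    TensorProduct.map S.hor.val.toLinearMap (S.gammaC.val.toLinearMap ∘ₗ ω) ∘ₗ S.coactHor

/-- `∑ ω(γ₁) γ₀` for a horizontal form `γ`. -/
def convR (ω : H →ₗ[ℂ] S.gammaC) : S.hor →ₗ[ℂ] S.Tot :=
  LinearMap.mul' ℂ S.Tot ∘ₗ (TensorProduct.comm ℂ S.Tot S.Tot).toLinearMap ∘ₗ
    TensorProduct.map S.hor.val.toLinearMap (S.gammaC.val.toLinearMap ∘ₗ ω) ∘ₗ S.coactHor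

end Coaction

end DifferentialStructure
end Bundle
end QPB
end

/-! Over one trivialization the horizontal forms are `Γ(B_i) ⊗̂ H`, so the Leibniz rule determines a
covariant derivative by its values on the elements `1 ⊗ h`. These values are `1 ⊗ dh` plus the
convolution product `∑ (1 ⊗ h₁)ω(h₂)` (the opposite product `∑ ω(h₂)(1 ⊗ h₁)` on the right) with the
local component of the form. The antipode (its inverse on the right) makes this convolution
invertible, so that values and local forms determine each other, and under this correspondence the
covariance of `D` becomes the adjoint covariance of `ω`, and the horizontality of `D` the prescribed
vertical part of `ω`. The same invertibility, applied on the quotient belonging to an overlap, shows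
that the local forms of a globally defined `D` agree there and thus glue to a form on `Γ_c(P)`. -/

open scoped TensorProduct

noncomputable section

namespace QPB

/-! ### Convolution along a coaction -/

section Convolution

variable {R V W H A A' : Type*} [CommRing R] [AddCommGroup V] [Module R V]
  [AddCommGroup W] [Module R W] [AddCommGroup H] [Module R H] [Ring A] [Algebra R A]
  [Ring A'] [Algebra R A']

/-- The convolution product `x ↦ ∑ f(x₀)g(x₁)` along `δ : x ↦ ∑ x₀ ⊗ x₁`. For the comultiplication
this is the usual convolution product, for a coaction it is the pairing of the proposition. -/
def conv (δ : V →ₗ[R] V ⊗[R] H) (f : V →ₗ[R] A) (g : H →ₗ[R] A) : V →ₗ[R] A :=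
  LinearMap.mul' R A ∘ₗ TensorProduct.map f g ∘ₗ δ

/-- The opposite convolution product `x ↦ ∑ g(x₁)f(x₀)` along `δ : x ↦ ∑ x₀ ⊗ x₁`. -/
def convOp (δ : V →ₗ[R] V ⊗[R] H) (f : V →ₗ[R] A) (g : H →ₗ[R] A) : V →ₗ[R] A :=
  LinearMap.mul' R A ∘ₗ (TensorProduct.comm R A A).toLinearMap ∘ₗ TensorProduct.map f g ∘ₗ δ

variable {δ : V →ₗ[R] V ⊗[R] H}

lemma conv_add (f : V →ₗ[R] A) (g g' : H →ₗ[R] A) :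
    conv δ f (g + g') = conv δ f g + conv δ f g' := by
  simp only [conv, TensorProduct.map_add_right, LinearMap.add_comp, LinearMap.comp_add]

lemma conv_smul (f : V →ₗ[R] A) (c : R) (g : H →ₗ[R] A) :
    conv δ f (c • g) = c • conv δ f g := by
  simp only [conv, TensorProduct.map_smul_right, LinearMap.smul_comp, LinearMap.comp_smul]

lemma convOp_add (f : V →ₗ[R] A) (g g' : H →ₗ[R] A) :
    convOp δ f (g + g') = convOp δ f g + convOp δ f g' := by
  simp only [convOp, TensorProduct.map_add_right, LinearMap.add_comp, LinearMap.comp_add]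

lemma convOp_smul (f : V →ₗ[R] A) (c : R) (g : H →ₗ[R] A) :
    convOp δ f (c • g) = c • convOp δ f g := by
  simp only [convOp, TensorProduct.map_smul_right, LinearMap.smul_comp, LinearMap.comp_smul]

lemma algHom_comp_conv (φ : A →ₐ[R] A') (f : V →ₗ[R] A) (g : H →ₗ[R] A) :
    φ.toLinearMap ∘ₗ conv δ f g = conv δ (φ.toLinearMap ∘ₗ f) (φ.toLinearMap ∘ₗ g) := by
  simp only [conv, TensorProduct.map_comp, ← LinearMap.comp_assoc, AlgHom.comp_mul']

lemma algHom_comp_convOp (φ : A →ₐ[R] A') (f : V →ₗ[R] A) (g : H →ₗ[R] A) :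
    φ.toLinearMap ∘ₗ convOp δ f g = convOp δ (φ.toLinearMap ∘ₗ f) (φ.toLinearMap ∘ₗ g) := by
  simp only [convOp, ← LinearMap.comp_assoc]
  congr 1
  ext x y
  simp

/-- `f` intertwines `δ` and `δ'`. With `δ` the comultiplication or an adjoint coaction this is the
covariance of fibre maps and of pre-connection forms. -/
def IsEquivariant (δ : V →ₗ[R] V ⊗[R] H) (δ' : W →ₗ[R] W ⊗[R] H) (f : V →ₗ[R] W) : Prop :=
  δ' ∘ₗ f = LinearMap.rTensor H f ∘ₗ δ

namespace IsEquivariant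

variable {U : Type*} [AddCommGroup U] [Module R U] {δ' : W →ₗ[R] W ⊗[R] H} {δ'' : U →ₗ[R] U ⊗[R] H}
  {k k' : V →ₗ[R] W}

lemma apply (hk : IsEquivariant δ δ' k) (x : V) : δ' (k x) = LinearMap.rTensor H k (δ x) :=
  LinearMap.congr_fun hk x

lemma add (hk : IsEquivariant δ δ' k) (hk' : IsEquivariant δ δ' k') :
    IsEquivariant δ δ' (k + k') := by
  rw [IsEquivariant, LinearMap.comp_add, hk, hk', LinearMap.rTensor_add, LinearMap.add_comp]

lemma sub (hk : IsEquivariant δ δ' k) (hk' : IsEquivariant δ δ' k') :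
    IsEquivariant δ δ' (k - k') := by
  rw [IsEquivariant, LinearMap.comp_sub, hk, hk', LinearMap.rTensor_sub, LinearMap.sub_comp]

lemma comp {l : W →ₗ[R] U} (hl : IsEquivariant δ' δ'' l) (hk : IsEquivariant δ δ' k) :
    IsEquivariant δ δ'' (l ∘ₗ k) := by
  rw [IsEquivariant, ← LinearMap.comp_assoc, hl, LinearMap.comp_assoc, hk, LinearMap.rTensor_comp,
    LinearMap.comp_assoc]

lemma conv_comp (hk : IsEquivariant δ δ' k) (f : W →ₗ[R] A) (g : H →ₗ[R] A) :
    conv δ' f g ∘ₗ k = conv δ (f ∘ₗ k) g := by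
  rw [conv, LinearMap.comp_assoc, LinearMap.comp_assoc, hk, ← LinearMap.comp_assoc δ,
    LinearMap.map_comp_rTensor, conv]

lemma convOp_comp (hk : IsEquivariant δ δ' k) (f : W →ₗ[R] A) (g : H →ₗ[R] A) :
    convOp δ' f g ∘ₗ k = convOp δ (f ∘ₗ k) g := by
  rw [convOp, LinearMap.comp_assoc, LinearMap.comp_assoc, LinearMap.comp_assoc, hk,
    ← LinearMap.comp_assoc δ, LinearMap.map_comp_rTensor, convOp]

end IsEquivariant

lemma comp_conv_of_mul {L : A →ₗ[R] A} {f : V →ₗ[R] A} (hL : ∀ x a, L (f x * a) = f x * L a)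
    (g : H →ₗ[R] A) : L ∘ₗ conv δ f g = conv δ f (L ∘ₗ g) := by
  simp only [conv, ← LinearMap.comp_assoc]
  congr 1
  ext x h
  simp [hL]

lemma comp_convOp_of_mul {L : A →ₗ[R] A} {f : V →ₗ[R] A} (hL : ∀ x a, L (a * f x) = L a * f x)
    (g : H →ₗ[R] A) : L ∘ₗ convOp δ f g = convOp δ f (L ∘ₗ g) := by
  simp only [convOp, ← LinearMap.comp_assoc]
  congr 1
  ext x h
  simp [hL]

lemma conv_mulLeft (a : A) (f : V →ₗ[R] A) (g : H →ₗ[R] A) :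
    conv δ (LinearMap.mulLeft R a ∘ₗ f) g = LinearMap.mulLeft R a ∘ₗ conv δ f g := by
  simp only [conv, ← LinearMap.comp_assoc]
  congr 1
  ext x h
  simp [mul_assoc]

lemma convOp_mulRight (a : A) (f : V →ₗ[R] A) (g : H →ₗ[R] A) :
    convOp δ (LinearMap.mulRight R a ∘ₗ f) g = LinearMap.mulRight R a ∘ₗ convOp δ f g := by
  simp only [convOp, ← LinearMap.comp_assoc]
  congr 1
  ext x h
  simp [mul_assoc]

lemma conv_apply_mem {X : Submodule R V} {U : Submodule R A} {f : V →ₗ[R] A} {g : H →ₗ[R] A} {x : V}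
    (hx : δ x ∈ LinearMap.range (LinearMap.rTensor H X.subtype))
    (hfg : ∀ v ∈ X, ∀ h, f v * g h ∈ U) : conv δ f g x ∈ U := by
  obtain ⟨t, ht⟩ := hx
  rw [conv, LinearMap.comp_apply, LinearMap.comp_apply, ← ht]
  clear ht
  induction t with
  | zero => simp
  | tmul v h => simpa using hfg v v.2 h
  | add s t hs ht => simpa only [map_add] using add_mem hs ht

lemma convOp_apply_mem {X : Submodule R V} {U : Submodule R A} {f : V →ₗ[R] A} {g : H →ₗ[R] A}
    {x : V} (hx : δ x ∈ LinearMap.range (LinearMap.rTensor H X.subtype))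
    (hfg : ∀ v ∈ X, ∀ h, g h * f v ∈ U) : convOp δ f g x ∈ U := by
  obtain ⟨t, ht⟩ := hx
  rw [convOp, LinearMap.comp_apply, LinearMap.comp_apply, LinearMap.comp_apply, ← ht]
  clear ht
  induction t with
  | zero => simp
  | tmul v h => simpa using hfg v v.2 h
  | add s t hs ht => simpa only [map_add] using add_mem hs ht

end Convolution

section Coalgebra

variable {R H A : Type*} [CommRing R] [AddCommGroup H] [Module R H] [Coalgebra R H]
  [Ring A] [Algebra R A]

open Coalgebra

variable (R H A) in
/-- The unit `h ↦ ε(h)1` of both convolution products on `H →ₗ[R] A`. -/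
def convUnit : H →ₗ[R] A := Algebra.linearMap R A ∘ₗ counit

lemma conv_comul_assoc (f g k : H →ₗ[R] A) :
    conv comul (conv comul f g) k = conv comul f (conv comul g k) :=
  congrArg WithConv.ofConv
    (mul_assoc (WithConv.toConv f) (WithConv.toConv g) (WithConv.toConv k))

lemma convUnit_conv (f : H →ₗ[R] A) : conv comul (convUnit R H A) f = f :=
  congrArg WithConv.ofConv (one_mul (WithConv.toConv f))

lemma op_comp_convOp (f g : H →ₗ[R] A) :
    (MulOpposite.opLinearEquiv R : A ≃ₗ[R] Aᵐᵒᵖ).toLinearMap ∘ₗ convOp comul f g =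
      conv comul ((MulOpposite.opLinearEquiv R : A ≃ₗ[R] Aᵐᵒᵖ).toLinearMap ∘ₗ f)
        ((MulOpposite.opLinearEquiv R : A ≃ₗ[R] Aᵐᵒᵖ).toLinearMap ∘ₗ g) := by
  simp only [convOp, conv, ← LinearMap.comp_assoc]
  congr 1
  ext x y
  simp

lemma convOp_comul_assoc (f g k : H →ₗ[R] A) :
    convOp comul (convOp comul f g) k = convOp comul f (convOp comul g k) := by
  apply (LinearMap.cancel_left (MulOpposite.opLinearEquiv R : A ≃ₗ[R] Aᵐᵒᵖ).injective).1
  simp only [op_comp_convOp, conv_comul_assoc]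

lemma convUnit_convOp (f : H →ₗ[R] A) : convOp comul (convUnit R H A) f = f := by
  apply (LinearMap.cancel_left (MulOpposite.opLinearEquiv R : A ≃ₗ[R] Aᵐᵒᵖ).injective).1
  rw [op_comp_convOp]
  exact convUnit_conv _

end Coalgebra

section Bialgebra

variable {R H A : Type*} [CommRing R] [Ring H] [Bialgebra R H] [Ring A] [Algebra R A]

open Coalgebra Algebra.TensorProduct

lemma conv_comul_one (f g : H →ₗ[R] A) : conv comul f g 1 = f 1 * g 1 := by
  simp [conv, Algebra.TensorProduct.one_def]

lemma convOp_comul_one (f g : H →ₗ[R] A) : convOp comul f g 1 = g 1 * f 1 := by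
  simp [convOp, Algebra.TensorProduct.one_def]

lemma algHom_comp_convUnit (j : H →ₐ[R] A) :
    j.toLinearMap ∘ₗ convUnit R H H = convUnit R H A := by
  ext h
  simp [convUnit]

lemma rTensor_comp_comul_eq_conv (f : H →ₗ[R] A) :
    LinearMap.rTensor H f ∘ₗ comul =
      conv comul ((includeLeft : A →ₐ[R] A ⊗[R] H).toLinearMap ∘ₗ f)
        (includeRight : H →ₐ[R] A ⊗[R] H).toLinearMap := by
  rw [conv, ← LinearMap.comp_assoc]
  congr 1
  ext x y
  simp

lemma rTensor_comp_comul_eq_convOp (f : H →ₗ[R] A) :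
    LinearMap.rTensor H f ∘ₗ comul =
      convOp comul ((includeLeft : A →ₐ[R] A ⊗[R] H).toLinearMap ∘ₗ f)
        (includeRight : H →ₐ[R] A ⊗[R] H).toLinearMap := by
  simp only [convOp, ← LinearMap.comp_assoc]
  congr 1
  ext x y
  simp

end Bialgebra

/-! ### Cancellation of an algebra homomorphism in a convolution product -/

section Cancellation

variable {R H A : Type*} [CommRing R] [Ring H] [HopfAlgebra R H] [Ring A] [Algebra R A]

open Coalgebra HopfAlgebra

lemma conv_antipode_algHom (j : H →ₐ[R] A) :
    conv comul (j.toLinearMap ∘ₗ antipode R) j.toLinearMap = convUnit R H A := by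
  have h := algHom_comp_conv (δ := comul) j (antipode R) LinearMap.id
  rw [LinearMap.comp_id] at h
  rw [← h, ← algHom_comp_convUnit j]
  exact congrArg _ mul_antipode_rTensor_comul

lemma conv_algHom_antipode (j : H →ₐ[R] A) :
    conv comul j.toLinearMap (j.toLinearMap ∘ₗ antipode R) = convUnit R H A := by
  have h := algHom_comp_conv (δ := comul) j LinearMap.id (antipode R)
  rw [LinearMap.comp_id] at h
  rw [← h, ← algHom_comp_convUnit j]
  exact congrArg _ mul_antipode_lTensor_comul

/-- Convolution on the left with an algebra homomorphism `j`. Its inverse is convolution with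
`j ∘ S`. -/
def convEquiv (j : H →ₐ[R] A) : (H →ₗ[R] A) ≃ₗ[R] (H →ₗ[R] A) where
  toFun := conv comul j.toLinearMap
  map_add' := conv_add _
  map_smul' := conv_smul _
  invFun := conv comul (j.toLinearMap ∘ₗ antipode R)
  left_inv f := by rw [← conv_comul_assoc, conv_antipode_algHom, convUnit_conv]
  right_inv f := by rw [← conv_comul_assoc, conv_algHom_antipode, convUnit_conv]

lemma convEquiv_apply (j : H →ₐ[R] A) (f : H →ₗ[R] A) :
    convEquiv j f = conv comul j.toLinearMap f := rfl

lemma convEquiv_symm_apply (j : H →ₐ[R] A) (f : H →ₗ[R] A) :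
    (convEquiv j).symm f = conv comul (j.toLinearMap ∘ₗ antipode R) f := rfl

end Cancellation

section AntipodeInv

variable {H A : Type*} [Ring H] [HopfAlgebra ℂ H] [Ring A] [Algebra ℂ A]

open Coalgebra HopfAlgebra

variable (hS : Function.Bijective (antipode ℂ : H →ₗ[ℂ] H))

lemma antipode_comp_antipodeInv : antipode ℂ ∘ₗ antipodeInv H hS = LinearMap.id :=
  LinearMap.ext (LinearEquiv.ofBijective (antipode ℂ : H →ₗ[ℂ] H) hS).apply_symm_apply

lemma antipode_comp_convOp (f g : H →ₗ[ℂ] H) :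
    antipode ℂ ∘ₗ convOp comul f g = conv comul (antipode ℂ ∘ₗ f) (antipode ℂ ∘ₗ g) := by
  simp only [convOp, conv, ← LinearMap.comp_assoc]
  congr 1
  ext x y
  simp [antipode_mul_antidistrib]

lemma antipode_comp_convUnit :
    antipode ℂ ∘ₗ convUnit ℂ H H = convUnit ℂ H H := by
  ext h
  simp [convUnit, Algebra.algebraMap_eq_smul_one]

lemma convOp_antipodeInv_algHom (j : H →ₐ[ℂ] A) :
    convOp comul (j.toLinearMap ∘ₗ antipodeInv H hS) j.toLinearMap =
      convUnit ℂ H A := by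
  have h := algHom_comp_convOp (δ := comul) j (antipodeInv H hS) LinearMap.id
  rw [LinearMap.comp_id] at h
  rw [← h, ← algHom_comp_convUnit j]
  congr 1
  rw [← LinearMap.cancel_left hS.1, antipode_comp_convOp, antipode_comp_antipodeInv,
    antipode_comp_convUnit]
  exact mul_antipode_lTensor_comul

lemma convOp_algHom_antipodeInv (j : H →ₐ[ℂ] A) :
    convOp comul j.toLinearMap (j.toLinearMap ∘ₗ antipodeInv H hS) =
      convUnit ℂ H A := by
  have h := algHom_comp_convOp (δ := comul) j LinearMap.id (antipodeInv H hS)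
  rw [LinearMap.comp_id] at h
  rw [← h, ← algHom_comp_convUnit j]
  congr 1
  rw [← LinearMap.cancel_left hS.1, antipode_comp_convOp, antipode_comp_antipodeInv,
    antipode_comp_convUnit]
  exact mul_antipode_rTensor_comul

/-- Opposite convolution with an algebra homomorphism `j`. Its inverse is opposite convolution with
`j ∘ S⁻¹`. -/
def convOpEquiv (j : H →ₐ[ℂ] A) : (H →ₗ[ℂ] A) ≃ₗ[ℂ] (H →ₗ[ℂ] A) where
  toFun := convOp comul j.toLinearMap
  map_add' := convOp_add _
  map_smul' := convOp_smul _
  invFun := convOp comul (j.toLinearMap ∘ₗ antipodeInv H hS)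
  left_inv f := by rw [← convOp_comul_assoc, convOp_antipodeInv_algHom, convUnit_convOp]
  right_inv f := by rw [← convOp_comul_assoc, convOp_algHom_antipodeInv, convUnit_convOp]

lemma convOpEquiv_apply (j : H →ₐ[ℂ] A) (f : H →ₗ[ℂ] A) :
    convOpEquiv hS j f = convOp comul j.toLinearMap f := rfl

lemma convOpEquiv_symm_apply (j : H →ₐ[ℂ] A) (f : H →ₗ[ℂ] A) :
    (convOpEquiv hS j).symm f = convOp comul (j.toLinearMap ∘ₗ antipodeInv H hS) f := rfl

end AntipodeInv

/-! ### Equivariance -/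

section Equivariance

variable {H A : Type*} [Ring H] [HopfAlgebra ℂ H] [Ring A] [Algebra ℂ A]

open Coalgebra HopfAlgebra Algebra.TensorProduct

lemma rTensor_comp_adL (f : H →ₗ[ℂ] A) :
    LinearMap.rTensor H f ∘ₗ adL H =
      (convEquiv (includeRight : H →ₐ[ℂ] A ⊗[ℂ] H)).symm (LinearMap.rTensor H f ∘ₗ comul) := by
  rw [convEquiv_symm_apply, conv, ← LinearMap.map_comp_lTensor]
  simp only [adL, comulSwap, ← LinearMap.comp_assoc]
  congr 2
  ext x y z
  simp

lemma rTensor_comp_adR (hS : Function.Bijective (antipode ℂ : H →ₗ[ℂ] H)) (f : H →ₗ[ℂ] A) :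
    LinearMap.rTensor H f ∘ₗ adR H hS =
      (convOpEquiv hS (includeRight : H →ₐ[ℂ] A ⊗[ℂ] H)).symm
        (LinearMap.rTensor H f ∘ₗ comul) := by
  rw [convOpEquiv_symm_apply, convOp, ← LinearMap.map_comp_lTensor]
  simp only [adR, comulSwap, ← LinearMap.comp_assoc]
  congr 2
  ext x y z
  simp

/-- `∑ (j(h₁) ⊗ h₂)(ω(h₄) ⊗ S(h₃)h₅) = ∑ j(h₁)ω(h₂) ⊗ h₃`. -/
lemma conv_rTensor_adL (j ω : H →ₗ[ℂ] A) :
    conv comul (LinearMap.rTensor H j ∘ₗ comul) (LinearMap.rTensor H ω ∘ₗ adL H) =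
      LinearMap.rTensor H (conv comul j ω) ∘ₗ comul := by
  rw [rTensor_comp_adL, rTensor_comp_comul_eq_conv j, conv_comul_assoc, ← convEquiv_apply,
    LinearEquiv.apply_symm_apply, rTensor_comp_comul_eq_conv, rTensor_comp_comul_eq_conv,
    ← conv_comul_assoc, algHom_comp_conv]

/-- `∑ (ω(h₄) ⊗ h₅S⁻¹(h₃))(j(h₁) ⊗ h₂) = ∑ ω(h₂)j(h₁) ⊗ h₃`. -/
lemma convOp_rTensor_adR (hS : Function.Bijective (antipode ℂ : H →ₗ[ℂ] H)) (j ω : H →ₗ[ℂ] A) :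
    convOp comul (LinearMap.rTensor H j ∘ₗ comul) (LinearMap.rTensor H ω ∘ₗ adR H hS) =
      LinearMap.rTensor H (convOp comul j ω) ∘ₗ comul := by
  rw [rTensor_comp_adR, rTensor_comp_comul_eq_convOp j, convOp_comul_assoc,
    ← convOpEquiv_apply hS, LinearEquiv.apply_symm_apply, rTensor_comp_comul_eq_convOp,
    rTensor_comp_comul_eq_convOp, ← convOp_comul_assoc, algHom_comp_convOp]

variable {ρ : A →ₐ[ℂ] A ⊗[ℂ] H} {j : H →ₐ[ℂ] A}

lemma isEquivariant_conv_iff (hj : IsEquivariant comul ρ.toLinearMap j.toLinearMap)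
    (ω : H →ₗ[ℂ] A) :
    IsEquivariant comul ρ.toLinearMap (conv comul j.toLinearMap ω) ↔
      IsEquivariant (adL H) ρ.toLinearMap ω := by
  rw [IsEquivariant, ← conv_rTensor_adL, algHom_comp_conv, hj, ← hj]
  exact (convEquiv (ρ.comp j)).injective.eq_iff

lemma isEquivariant_convOp_iff (hS : Function.Bijective (antipode ℂ : H →ₗ[ℂ] H))
    (hj : IsEquivariant comul ρ.toLinearMap j.toLinearMap) (ω : H →ₗ[ℂ] A) :
    IsEquivariant comul ρ.toLinearMap (convOp comul j.toLinearMap ω) ↔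
      IsEquivariant (adR H hS) ρ.toLinearMap ω := by
  rw [IsEquivariant, ← convOp_rTensor_adR hS, algHom_comp_convOp, hj, ← hj]
  exact (convOpEquiv hS (ρ.comp j)).injective.eq_iff

end Equivariance

/-! ### Slices -/

section Slice

variable {V W H : Type*} [AddCommGroup V] [Module ℂ V] [AddCommGroup W] [Module ℂ W]
  [AddCommGroup H] [Module ℂ H]

lemma eq_of_slice {s t : V ⊗[ℂ] H} (h : ∀ φ : H →ₗ[ℂ] ℂ, slice V φ s = slice V φ t) : s = t := by
  have h0 : s - t ∈ LinearMap.range (LinearMap.rTensor H (⊥ : Submodule ℂ V).subtype) :=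
    mem_range_of_slice ⊥ _ fun φ => by simp [h]
  obtain ⟨u, hu⟩ := h0
  have : (⊥ : Submodule ℂ V).subtype = 0 := by
    ext x; exact (Submodule.mem_bot ℂ).1 x.2
  rw [this, LinearMap.rTensor_zero, LinearMap.zero_apply] at hu
  exact sub_eq_zero.1 hu.symm

lemma rTensor_eq_of_ker_le {W' : Type*} [AddCommGroup W'] [Module ℂ W'] {f : V →ₗ[ℂ] W}
    {g : V →ₗ[ℂ] W'} (hfg : ∀ v, f v = 0 → g v = 0) {s t : V ⊗[ℂ] H}
    (h : LinearMap.rTensor H f s = LinearMap.rTensor H f t) :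
    LinearMap.rTensor H g s = LinearMap.rTensor H g t := by
  refine eq_of_slice fun φ => ?_
  rw [slice_rTensor, slice_rTensor, ← sub_eq_zero, ← map_sub, ← map_sub]
  apply hfg
  rw [map_sub, map_sub, ← slice_rTensor, ← slice_rTensor, h, sub_self]

lemma eq_of_rTensor_eq {ι : Type*} {W : ι → Type*} [∀ i, AddCommGroup (W i)] [∀ i, Module ℂ (W i)]
    {f : ∀ i, V →ₗ[ℂ] W i} (hf : ∀ v, (∀ i, f i v = 0) → v = 0) {s t : V ⊗[ℂ] H}
    (h : ∀ i, LinearMap.rTensor H (f i) s = LinearMap.rTensor H (f i) t) : s = t := by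
  refine eq_of_slice fun φ => ?_
  rw [← sub_eq_zero]
  refine hf _ fun i => ?_
  rw [map_sub, ← slice_rTensor, ← slice_rTensor, h, sub_self]

end Slice

/-! ### The skew tensor product of two differential calculi -/

lemma DifferentialCalculus.one_mem_gr {A : Type*} [Ring A] [Algebra ℂ A]
    (Γ : DifferentialCalculus A) : (1 : Γ.carrier) ∈ Γ.gr 0 :=
  SetLike.GradedOne.one_mem

section Skew

variable {A : Type*} [Ring A] [Algebra ℂ A] {C : Type*} [Ring C] [Algebra ℂ C]
variable (Γ : DifferentialCalculus A) (Λ : DifferentialCalculus C)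

/-- The homomorphism `a ↦ a ⊗ 1`. -/
def inl : Γ.carrier →ₐ[ℂ] Skew Γ Λ := GradedTensorProduct.includeLeft Γ.gr Λ.gr

/-- The homomorphism `b ↦ 1 ⊗ b`. -/
def inr : Λ.carrier →ₐ[ℂ] Skew Γ Λ := GradedTensorProduct.includeRight Γ.gr Λ.gr

/-- The homomorphism `h ↦ 1 ⊗ h` on the elements of degree zero. -/
def fib : C →ₐ[ℂ] Skew Γ Λ := (inr Γ Λ).comp Λ.of

variable {Γ Λ}

lemma inl_apply (a : Γ.carrier) : inl Γ Λ a = skewTmul Γ Λ a 1 := rfl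

lemma inr_apply (b : Λ.carrier) : inr Γ Λ b = skewTmul Γ Λ 1 b := rfl

lemma fib_apply (h : C) : fib Γ Λ h = skewTmul Γ Λ 1 (Λ.of h) := rfl

lemma inl_mul_skewTmul (a a' : Γ.carrier) (b : Λ.carrier) :
    inl Γ Λ a * skewTmul Γ Λ a' b = skewTmul Γ Λ (a * a') b := skewTmul_one_mul a a' b

lemma fib_mul_skewTmul (h : C) (a : Γ.carrier) (b : Λ.carrier) :
    fib Γ Λ h * skewTmul Γ Λ a b = skewTmul Γ Λ a (Λ.of h * b) := by
  rw [fib_apply, skewTmul_of_mul, one_mul]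

lemma skewTmul_mul_fib (a : Γ.carrier) (b : Λ.carrier) (h : C) :
    skewTmul Γ Λ a b * fib Γ Λ h = skewTmul Γ Λ a (b * Λ.of h) := by
  induction b using DirectSum.Decomposition.inductionOn Λ.gr with
  | zero => simp [skewTmul]
  | homogeneous b =>
    rw [fib_apply, skewTmul_mul a b.2 Γ.one_mem_gr (Λ.of h), mul_zero, pow_zero, one_smul, mul_one]
  | add x y hx hy =>
    simp only [skewTmul, TensorProduct.tmul_add, add_mul, map_add] at *
    rw [hx, hy]

lemma inl_mul_inr (a : Γ.carrier) (b : Λ.carrier) :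
    inl Γ Λ a * inr Γ Λ b = skewTmul Γ Λ a b := by
  rw [inr_apply, inl_mul_skewTmul, mul_one]

lemma inl_mul_fib (a : Γ.carrier) (h : C) :
    inl Γ Λ a * fib Γ Λ h = skewTmul Γ Λ a (Λ.of h) := inl_mul_inr a (Λ.of h)

lemma fib_mul_inl (a : Γ.carrier) (h : C) :
    fib Γ Λ h * inl Γ Λ a = inl Γ Λ a * fib Γ Λ h := by
  rw [inl_mul_fib, inl_apply, fib_mul_skewTmul, mul_one]

lemma skewTmul_induction {motive : Skew Γ Λ → Prop} (x : Skew Γ Λ) (zero : motive 0)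
    (tmul : ∀ (i j : ℕ) (a : Γ.carrier) (b : Λ.carrier), a ∈ Γ.gr i → b ∈ Λ.gr j →
      motive (skewTmul Γ Λ a b))
    (add : ∀ x y, motive x → motive y → motive (x + y)) : motive x := by
  obtain ⟨t, rfl⟩ := (skewEquiv Γ Λ).surjective x
  induction t with
  | zero => simpa using zero
  | add s t hs ht => rw [map_add]; exact add _ _ hs ht
  | tmul a b =>
    induction a using DirectSum.Decomposition.inductionOn Γ.gr with
    | zero => simpa using zero
    | add a a' ha ha' => rw [TensorProduct.add_tmul, map_add]; exact add _ _ ha ha'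
    | @homogeneous i a =>
      induction b using DirectSum.Decomposition.inductionOn Λ.gr with
      | zero => simpa using zero
      | add b b' hb hb' => rw [TensorProduct.tmul_add, map_add]; exact add _ _ hb hb'
      | @homogeneous j b => exact tmul i j a b a.2 b.2

lemma inl_mem_horLoc (a : Γ.carrier) : inl Γ Λ a ∈ horLoc Γ Λ :=
  (mem_horLoc _ _).2 ⟨a ⊗ₜ 1, by simp [inl_apply]⟩

lemma skewOf_mem_horLoc (t : A ⊗[ℂ] C) : skewOf Γ Λ t ∈ horLoc Γ Λ := by
  refine (mem_horLoc _ _).2 ⟨TensorProduct.map Γ.of.toLinearMap LinearMap.id t, ?_⟩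
  rw [TensorProduct.map_map, LinearMap.id_comp, LinearMap.comp_id]
  rfl

lemma fib_mem_horLoc (h : C) : fib Γ Λ h ∈ horLoc Γ Λ :=
  (mem_horLoc _ _).2 ⟨1 ⊗ₜ h, rfl⟩

@[elab_as_elim]
lemma horLoc_induction {motive : (x : Skew Γ Λ) → x ∈ horLoc Γ Λ → Prop}
    (zero : motive 0 (zero_mem _))
    (mul : ∀ (n : ℕ) (a : Γ.carrier) (h : C) (_ : a ∈ Γ.gr n) (hx : inl Γ Λ a * fib Γ Λ h ∈ _),
      motive (inl Γ Λ a * fib Γ Λ h) hx)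
    (add : ∀ x y hx hy, motive x hx → motive y hy → motive (x + y) (add_mem hx hy))
    {x : Skew Γ Λ} (hx : x ∈ horLoc Γ Λ) : motive x hx := by
  suffices h : ∃ hx, motive x hx from h.2
  obtain ⟨t, rfl⟩ := (mem_horLoc _ _).1 hx
  clear hx
  induction t with
  | zero => rw [map_zero, map_zero]; exact ⟨_, zero⟩
  | add s t hs ht =>
    obtain ⟨hs, hs'⟩ := hs
    obtain ⟨ht, ht'⟩ := ht
    rw [map_add, map_add]
    exact ⟨_, add _ _ hs ht hs' ht'⟩
  | tmul a h =>
    change ∃ hx, motive (skewTmul Γ Λ a (Λ.of h)) hx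
    rw [← inl_mul_fib]
    induction a using DirectSum.Decomposition.inductionOn Γ.gr with
    | zero => rw [map_zero, zero_mul]; exact ⟨_, zero⟩
    | add a a' ha ha' =>
      obtain ⟨hs, hs'⟩ := ha
      obtain ⟨ht, ht'⟩ := ha'
      rw [map_add, add_mul]
      exact ⟨_, add _ _ hs ht hs' ht'⟩
    | @homogeneous n a =>
      exact ⟨mul_mem (inl_mem_horLoc _) (fib_mem_horLoc _), mul n a h a.2 _⟩

lemma skewTmul_smul_left (r : ℂ) (a : Γ.carrier) (b : Λ.carrier) :
    skewTmul Γ Λ (r • a) b = r • skewTmul Γ Λ a b := by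
  rw [← map_smul, TensorProduct.smul_tmul']

lemma skewTmul_smul_right (r : ℂ) (a : Γ.carrier) (b : Λ.carrier) :
    skewTmul Γ Λ a (r • b) = r • skewTmul Γ Λ a b := by
  rw [← map_smul, ← TensorProduct.tmul_smul]

lemma skewTmul_mem {p q : ℕ} {a : Γ.carrier} (ha : a ∈ Γ.gr p) {b : Λ.carrier} (hb : b ∈ Λ.gr q) :
    skewTmul Γ Λ a b ∈ skewGr Γ Λ (p + q) :=
  Submodule.subset_span ⟨p, q, rfl, a, ha, b, hb, rfl⟩

@[elab_as_elim]
lemma skewGr_induction {n : ℕ} {motive : (x : Skew Γ Λ) → x ∈ skewGr Γ Λ n → Prop}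
    (zero : motive 0 (zero_mem _))
    (tmul : ∀ (p q : ℕ) (a : Γ.carrier) (b : Λ.carrier) (_ : p + q = n) (_ : a ∈ Γ.gr p)
      (_ : b ∈ Λ.gr q) (hx : skewTmul Γ Λ a b ∈ _), motive (skewTmul Γ Λ a b) hx)
    (add : ∀ x y hx hy, motive x hx → motive y hy → motive (x + y) (add_mem hx hy))
    {x : Skew Γ Λ} (hx : x ∈ skewGr Γ Λ n) : motive x hx := by
  have hx' : x ∈ Submodule.span ℂ {z | ∃ p q : ℕ, p + q = n ∧ ∃ x ∈ Γ.gr p, ∃ y ∈ Λ.gr q,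
    z = skewTmul Γ Λ x y} := hx
  suffices h : ∃ hx, motive x hx from h.2
  clear hx
  induction hx' using Submodule.closure_induction with
  | zero => exact ⟨_, zero⟩
  | add x y _ _ hx hy =>
    obtain ⟨hx, hx'⟩ := hx
    obtain ⟨hy, hy'⟩ := hy
    exact ⟨_, add x y hx hy hx' hy'⟩
  | smul_mem r x h =>
    obtain ⟨p, q, rfl, a, ha, b, hb, rfl⟩ := h
    rw [← skewTmul_smul_left]
    exact ⟨skewTmul_mem (Submodule.smul_mem _ r ha) hb,
      tmul p q _ b rfl (Submodule.smul_mem _ r ha) hb _⟩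

lemma skewGr_mul {m n : ℕ} {x y : Skew Γ Λ} (hx : x ∈ skewGr Γ Λ m) (hy : y ∈ skewGr Γ Λ n) :
    x * y ∈ skewGr Γ Λ (m + n) := by
  induction hx using skewGr_induction with
  | zero => simp
  | add x x' _ _ hx hx' => rw [add_mul]; exact add_mem hx hx'
  | tmul p q a b hpq ha hb _ =>
    induction hy using skewGr_induction with
    | zero => simp
    | add y y' _ _ hy hy' => rw [mul_add]; exact add_mem hy hy'
    | tmul p' q' a' b' hpq' ha' hb' _ =>
      rw [skewTmul_mul a hb ha' b']
      refine Submodule.smul_mem _ _ ?_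
      have := skewTmul_mem (SetLike.GradedMul.mul_mem ha ha') (SetLike.GradedMul.mul_mem hb hb')
      rwa [show p + p' + (q + q') = m + n by omega] at this

lemma fib_mem_skewGr (h : C) : fib Γ Λ h ∈ skewGr Γ Λ 0 :=
  skewTmul_mem (p := 0) (q := 0) Γ.one_mem_gr (Λ.of_mem h)

lemma skewD_mem {n : ℕ} {x : Skew Γ Λ} (hx : x ∈ skewGr Γ Λ n) :
    skewD Γ Λ x ∈ skewGr Γ Λ (n + 1) := by
  induction hx using skewGr_induction with
  | zero => simp
  | add x x' _ _ hx hx' => rw [map_add]; exact add_mem hx hx'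
  | tmul p q a b hpq ha hb _ =>
    rw [skewD_tmul, Γ.parity_of_mem ha]
    refine add_mem ?_ ?_
    · have := skewTmul_mem (Γ.d_mem ha) hb
      rwa [show p + 1 + q = n + 1 by omega] at this
    · have := skewTmul_mem (Submodule.smul_mem _ ((-1 : ℂ) ^ p) ha) (Λ.d_mem hb)
      rwa [show p + (q + 1) = n + 1 by omega] at this

variable (Γ Λ) in
/-- The linear map with `x ↦ (-1)^n x` for `x` of total degree `n`. -/
def parityLoc : Skew Γ Λ →ₗ[ℂ] Skew Γ Λ :=
  (skewEquiv Γ Λ).toLinearMap ∘ₗ TensorProduct.map Γ.parity Λ.parity ∘ₗ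
    (skewEquiv Γ Λ).symm.toLinearMap

lemma parityLoc_tmul (a : Γ.carrier) (b : Λ.carrier) :
    parityLoc Γ Λ (skewTmul Γ Λ a b) = skewTmul Γ Λ (Γ.parity a) (Λ.parity b) := by
  simp [parityLoc, skewTmul]

lemma parityLoc_of_mem {n : ℕ} {x : Skew Γ Λ} (hx : x ∈ skewGr Γ Λ n) :
    parityLoc Γ Λ x = (-1 : ℂ) ^ n • x := by
  induction hx using skewGr_induction with
  | zero => simp
  | add x x' _ _ hx hx' => rw [map_add, hx, hx', smul_add]
  | tmul p q a b hpq ha hb _ =>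
    rw [parityLoc_tmul, Γ.parity_of_mem ha, Λ.parity_of_mem hb, skewTmul_smul_left,
      skewTmul_smul_right, smul_smul, ← pow_add, hpq]

lemma parityLoc_inl_mul_fib (a : Γ.carrier) (h : C) :
    parityLoc Γ Λ (inl Γ Λ a * fib Γ Λ h) = inl Γ Λ (Γ.parity a) * fib Γ Λ h := by
  rw [inl_mul_fib, parityLoc_tmul, Λ.parity_of_mem (Λ.of_mem h), pow_zero, one_smul, inl_mul_fib]

lemma parityLoc_mem_horLoc {x : Skew Γ Λ} (hx : x ∈ horLoc Γ Λ) :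
    parityLoc Γ Λ x ∈ horLoc Γ Λ := by
  induction hx using horLoc_induction with
  | zero => simp
  | add x y _ _ hx hy => rw [map_add]; exact add_mem hx hy
  | mul _ a h _ _ =>
    rw [parityLoc_inl_mul_fib]
    exact mul_mem (inl_mem_horLoc _) (fib_mem_horLoc _)

lemma skewD_inl (a : Γ.carrier) : skewD Γ Λ (inl Γ Λ a) = inl Γ Λ (Γ.d a) := by
  rw [inl_apply, skewD_tmul, Λ.d_one, inl_apply]
  simp [skewTmul]

lemma parity_one : Γ.parity 1 = 1 := by
  rw [Γ.parity_of_mem Γ.one_mem_gr, pow_zero, one_smul]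

lemma skewD_inr (b : Λ.carrier) : skewD Γ Λ (inr Γ Λ b) = inr Γ Λ (Λ.d b) := by
  rw [inr_apply, skewD_tmul, Γ.d_one, inr_apply, parity_one]
  simp [skewTmul]

lemma skewD_inl_mul_fib (a : Γ.carrier) (h : C) :
    skewD Γ Λ (inl Γ Λ a * fib Γ Λ h) =
      inl Γ Λ (Γ.d a) * fib Γ Λ h + inl Γ Λ (Γ.parity a) * inr Γ Λ (Λ.d (Λ.of h)) := by
  rw [inl_mul_fib, skewD_tmul, inl_mul_fib, inl_mul_inr]

lemma inr_d_mul_inl (a : Γ.carrier) (h : C) :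
    inr Γ Λ (Λ.d (Λ.of h)) * inl Γ Λ a = inl Γ Λ (Γ.parity a) * inr Γ Λ (Λ.d (Λ.of h)) := by
  induction a using DirectSum.Decomposition.inductionOn Γ.gr with
  | zero => simp
  | add a a' ha ha' => simp only [map_add, mul_add, add_mul, ha, ha']
  | @homogeneous n a =>
    rw [inl_mul_inr, inr_apply, inl_apply, skewTmul_mul _ (Λ.d_mem (Λ.of_mem h)) a.2,
      Γ.parity_of_mem a.2, skewTmul_smul_left]
    simp

variable (Γ Λ) in
/-- The projection `1 - hor_c` onto the vertical part. -/
def vertC : Skew Γ Λ →ₗ[ℂ] Skew Γ Λ := LinearMap.id - horC Γ Λ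

lemma vertC_tmul (a : Γ.carrier) (b : Λ.carrier) :
    vertC Γ Λ (skewTmul Γ Λ a b) = skewTmul Γ Λ a (b - Λ.projZero b) := by
  simp [vertC, horC, skewTmul, TensorProduct.tmul_sub]

lemma projZero_mem (b : Λ.carrier) : Λ.projZero b ∈ Λ.gr 0 := by
  simp [DifferentialCalculus.projZero, GradedAlgebra.proj_apply]

lemma projZero_of_mem {b : Λ.carrier} (hb : b ∈ Λ.gr 0) : Λ.projZero b = b := by
  rw [DifferentialCalculus.projZero, GradedAlgebra.proj_apply,
    DirectSum.decompose_of_mem_same _ hb]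

lemma projZero_of_mem_succ {n : ℕ} {b : Λ.carrier} (hb : b ∈ Λ.gr (n + 1)) :
    Λ.projZero b = 0 := by
  rw [DifferentialCalculus.projZero, GradedAlgebra.proj_apply,
    DirectSum.decompose_of_mem_ne _ hb (Nat.succ_ne_zero n)]

lemma projZero_of_mul (h : C) (b : Λ.carrier) :
    Λ.projZero (Λ.of h * b) = Λ.of h * Λ.projZero b := by
  simp only [DifferentialCalculus.projZero, GradedAlgebra.proj_apply]
  exact DirectSum.coe_decompose_mul_of_left_mem_zero Λ.gr (Λ.of_mem h)

lemma projZero_mul_of (h : C) (b : Λ.carrier) :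
    Λ.projZero (b * Λ.of h) = Λ.projZero b * Λ.of h := by
  simp only [DifferentialCalculus.projZero, GradedAlgebra.proj_apply]
  exact DirectSum.coe_decompose_mul_of_right_mem_zero Λ.gr (Λ.of_mem h)

lemma horC_mem (x : Skew Γ Λ) : horC Γ Λ x ∈ horLoc Γ Λ := by
  induction x using skewTmul_induction with
  | zero => simp
  | add x y hx hy => rw [map_add]; exact add_mem hx hy
  | tmul _ _ a b _ _ =>
    have h : Λ.projZero b ∈ LinearMap.range Λ.of.toLinearMap := by
      rw [Λ.range_of]; exact projZero_mem b
    obtain ⟨c, hc⟩ := h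
    refine (mem_horLoc _ _).2 ⟨a ⊗ₜ c, ?_⟩
    simp only [TensorProduct.map_tmul, hc]
    simp [horC, skewTmul]

lemma vertC_eq_zero_iff {x : Skew Γ Λ} : vertC Γ Λ x = 0 ↔ x ∈ horLoc Γ Λ := by
  constructor
  · intro h
    have h' : x = horC Γ Λ x := sub_eq_zero.1 h
    rw [h']
    exact horC_mem x
  · intro hx
    induction hx using horLoc_induction with
    | zero => simp
    | add x y _ _ hx hy => rw [map_add, hx, hy, add_zero]
    | mul _ a h _ _ =>
      rw [inl_mul_fib, vertC_tmul, projZero_of_mem (Λ.of_mem h), sub_self]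
      simp [skewTmul]

lemma vertC_inr_d (h : C) : vertC Γ Λ (inr Γ Λ (Λ.d (Λ.of h))) = inr Γ Λ (Λ.d (Λ.of h)) := by
  rw [inr_apply, vertC_tmul, projZero_of_mem_succ (Λ.d_mem (Λ.of_mem h)), sub_zero]

lemma vertC_fib_mul (h : C) (x : Skew Γ Λ) :
    vertC Γ Λ (fib Γ Λ h * x) = fib Γ Λ h * vertC Γ Λ x := by
  induction x using skewTmul_induction with
  | zero => simp
  | add x y hx hy => rw [mul_add, map_add, hx, hy, map_add, mul_add]
  | tmul _ _ a' b _ _ =>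
    rw [fib_mul_skewTmul, vertC_tmul, vertC_tmul, fib_mul_skewTmul, projZero_of_mul, mul_sub]

lemma vertC_mul_fib (h : C) (x : Skew Γ Λ) :
    vertC Γ Λ (x * fib Γ Λ h) = vertC Γ Λ x * fib Γ Λ h := by
  induction x using skewTmul_induction with
  | zero => simp
  | add x y hx hy => rw [add_mul, map_add, hx, hy, map_add, add_mul]
  | tmul _ _ a' b _ _ =>
    rw [skewTmul_mul_fib, vertC_tmul, vertC_tmul, skewTmul_mul_fib, projZero_mul_of, sub_mul]

end Skew

/-! ### The coaction on the skew tensor product -/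

section Local

open Coalgebra

variable {A : Type*} [Ring A] [Algebra ℂ A] {H : Type*} [Ring H] [HopfAlgebra ℂ H]
variable {Γ : DifferentialCalculus A} {Λ : RightCovariantCalculus H}

local notation "L" => Skew Γ Λ.toDifferentialCalculus
local notation "lft" => inl Γ Λ.toDifferentialCalculus
local notation "fbr" => fib Γ Λ.toDifferentialCalculus

variable (Γ Λ) in
/-- The coaction `id ⊗ Δ^Γ` as an algebra homomorphism. -/
def coactLocHom : L →ₐ[ℂ] L ⊗[ℂ] H :=
  AlgHom.ofLinearMap (coactLoc Γ Λ) (by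
    simpa [Algebra.TensorProduct.one_def] using coactLoc_algebraMap (Γ := Γ) (Λ := Λ) 1)
    coactLoc_mul

variable (Γ Λ) in
/-- The map `h ↦ 1 ⊗ dh`. -/
def fibD : H →ₗ[ℂ] L :=
  (inr Γ Λ.toDifferentialCalculus).toLinearMap ∘ₗ Λ.d ∘ₗ Λ.of.toLinearMap

lemma coactLoc_inl (a : Γ.carrier) : coactLoc Γ Λ (lft a) = lft a ⊗ₜ 1 := by
  rw [inl_apply, coactLoc_tmul, map_one, Algebra.TensorProduct.one_def, leftInsert_tmul]

lemma isEquivariant_inr_comp {k : H →ₗ[ℂ] Λ.carrier}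
    (hk : IsEquivariant comul Λ.coact.toLinearMap k) :
    IsEquivariant comul (coactLoc Γ Λ)
      ((inr Γ Λ.toDifferentialCalculus).toLinearMap ∘ₗ k) := by
  ext h
  change coactLoc Γ Λ (skewTmul Γ Λ.toDifferentialCalculus 1 (k h)) = _
  rw [coactLoc_tmul, LinearMap.rTensor_comp, LinearMap.comp_apply, LinearMap.comp_apply,
    ← hk.apply]
  rfl

lemma isEquivariant_fib : IsEquivariant comul (coactLoc Γ Λ) (fbr).toLinearMap :=
  isEquivariant_inr_comp (k := Λ.of.toLinearMap) (LinearMap.ext Λ.coact_of)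

lemma isEquivariant_fibD : IsEquivariant comul (coactLoc Γ Λ) (fibD Γ Λ) :=
  isEquivariant_inr_comp (LinearMap.ext Λ.coact_d_of)

lemma IsEquivariant.inl_mul {k : H →ₗ[ℂ] L} (hk : IsEquivariant comul (coactLoc Γ Λ) k)
    (a : Γ.carrier) :
    IsEquivariant comul (coactLoc Γ Λ) (LinearMap.mulLeft ℂ (lft a) ∘ₗ k) := by
  refine IsEquivariant.comp (LinearMap.ext fun x => ?_) hk
  rw [LinearMap.comp_apply, LinearMap.mulLeft_apply, coactLoc_mul, coactLoc_inl,
    LinearMap.comp_apply]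
  generalize coactLoc Γ Λ x = t
  induction t with
  | zero => simp
  | tmul x h => simp
  | add s t hs ht => simp only [map_add, mul_add, hs, ht]

lemma IsEquivariant.mul_inl {k : H →ₗ[ℂ] L} (hk : IsEquivariant comul (coactLoc Γ Λ) k)
    (a : Γ.carrier) :
    IsEquivariant comul (coactLoc Γ Λ) (LinearMap.mulRight ℂ (lft a) ∘ₗ k) := by
  refine IsEquivariant.comp (LinearMap.ext fun x => ?_) hk
  rw [LinearMap.comp_apply, LinearMap.mulRight_apply, coactLoc_mul, coactLoc_inl,
    LinearMap.comp_apply]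
  generalize coactLoc Γ Λ x = t
  induction t with
  | zero => simp
  | tmul x h => simp
  | add s t hs ht => simp only [map_add, add_mul, hs, ht]

/-- Horizontal elements are spanned by the products `(a ⊗ 1)(1 ⊗ h)`, whose first factor is
coinvariant. -/
lemma coactLoc_comm_of_isEquivariant {T : L →ₗ[ℂ] L}
    (hT : ∀ a, IsEquivariant comul (coactLoc Γ Λ)
      (T ∘ₗ LinearMap.mulLeft ℂ (lft a) ∘ₗ (fbr).toLinearMap))
    {x : L} (hx : x ∈ horLoc Γ Λ.toDifferentialCalculus) :
    coactLoc Γ Λ (T x) = LinearMap.rTensor H T (coactLoc Γ Λ x) := by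
  induction hx using horLoc_induction with
  | zero => simp
  | add x y _ _ hx hy => simp only [map_add, hx, hy]
  | mul _ a h _ _ =>
    refine ((hT a).apply h).trans ?_
    rw [LinearMap.rTensor_comp, LinearMap.comp_apply,
      ← (isEquivariant_fib.inl_mul a).apply, LinearMap.comp_apply]
    rfl

lemma coactLoc_mem_skewGr {n : ℕ} {x : L} (hx : x ∈ skewGr Γ Λ.toDifferentialCalculus n) :
    coactLoc Γ Λ x ∈
      LinearMap.range (LinearMap.rTensor H (skewGr Γ Λ.toDifferentialCalculus n).subtype) := by
  induction hx using skewGr_induction with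
  | zero => simp
  | add x y _ _ hx hy => rw [map_add]; exact add_mem hx hy
  | tmul p q a b hpq ha hb _ =>
    rw [coactLoc_tmul]
    obtain ⟨t, ht⟩ := coact_mem hb
    rw [← ht]
    clear ht
    induction t with
    | zero => simp
    | add s t hs ht => rw [map_add, map_add]; exact add_mem hs ht
    | tmul b h => exact ⟨⟨_, hpq ▸ skewTmul_mem ha b.2⟩ ⊗ₜ h, rfl⟩

/-! ### Local covariant derivatives -/

variable (ω : H →ₗ[ℂ] Skew Γ Λ.toDifferentialCalculus)

lemma conv_coactLoc_inl_mul_fib (a : Γ.carrier) (h : H) :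
    conv (coactLoc Γ Λ) LinearMap.id ω (lft a * fbr h) =
      lft a * conv comul (fbr).toLinearMap ω h := by
  have hconv := (isEquivariant_fib.inl_mul a).conv_comp LinearMap.id ω
  rw [LinearMap.id_comp, conv_mulLeft] at hconv
  exact LinearMap.congr_fun hconv h

lemma convOp_coactLoc_inl_mul_fib (a : Γ.carrier) (h : H) :
    convOp (coactLoc Γ Λ) LinearMap.id ω (lft a * fbr h) =
      convOp comul (fbr).toLinearMap ω h * lft a := by
  have hconv := (isEquivariant_fib.mul_inl a).convOp_comp LinearMap.id ω
  rw [LinearMap.id_comp, convOp_mulRight] at hconv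
  rw [← fib_mul_inl]
  exact LinearMap.congr_fun hconv h

/-- The operator `γ ↦ dγ + (-1)^n ∑ γ₀ω(γ₁)`, `γ` of degree `n`, over one trivialization. -/
def leftDerivLoc : L →ₗ[ℂ] L :=
  skewD Γ Λ.toDifferentialCalculus +
    conv (coactLoc Γ Λ) LinearMap.id ω ∘ₗ parityLoc Γ Λ.toDifferentialCalculus

/-- The operator `γ ↦ dγ + ∑ ω(γ₁)γ₀` over one trivialization. -/
def rightDerivLoc : L →ₗ[ℂ] L :=
  skewD Γ Λ.toDifferentialCalculus + convOp (coactLoc Γ Λ) LinearMap.id ω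

/-- The values `h ↦ dh + ∑ h₁ω(h₂)` of `leftDerivLoc ω` on the fibre. -/
def leftFibreDeriv : H →ₗ[ℂ] L := fibD Γ Λ + conv comul (fbr).toLinearMap ω

/-- The values `h ↦ dh + ∑ ω(h₂)h₁` of `rightDerivLoc ω` on the fibre. -/
def rightFibreDeriv : H →ₗ[ℂ] L := fibD Γ Λ + convOp comul (fbr).toLinearMap ω

lemma leftDerivLoc_inl_mul_fib (a : Γ.carrier) (h : H) :
    leftDerivLoc ω (lft a * fbr h) =
      lft (Γ.d a) * fbr h + lft (Γ.parity a) * leftFibreDeriv ω h := by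
  rw [leftDerivLoc, LinearMap.add_apply, LinearMap.comp_apply, parityLoc_inl_mul_fib,
    conv_coactLoc_inl_mul_fib, skewD_inl_mul_fib, leftFibreDeriv, LinearMap.add_apply, mul_add,
    add_assoc]
  rfl

lemma rightDerivLoc_inl_mul_fib (a : Γ.carrier) (h : H) :
    rightDerivLoc ω (lft a * fbr h) = lft (Γ.d a) * fbr h + rightFibreDeriv ω h * lft a := by
  rw [rightDerivLoc, LinearMap.add_apply, convOp_coactLoc_inl_mul_fib, skewD_inl_mul_fib,
    rightFibreDeriv, LinearMap.add_apply, add_mul, add_assoc, ← inr_d_mul_inl]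
  rfl

variable {ω}

lemma leftDerivLoc_fib (h : H) : leftDerivLoc ω (fbr h) = leftFibreDeriv ω h := by
  simpa [Γ.d_one, parity_one] using leftDerivLoc_inl_mul_fib ω 1 h

lemma rightDerivLoc_fib (h : H) : rightDerivLoc ω (fbr h) = rightFibreDeriv ω h := by
  simpa [Γ.d_one] using rightDerivLoc_inl_mul_fib ω 1 h

lemma leftDerivLoc_one (hω : ω 1 = 0) : leftDerivLoc ω 1 = 0 := by
  rw [← map_one fbr, leftDerivLoc_fib, leftFibreDeriv, LinearMap.add_apply, conv_comul_one, hω]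
  simp [fibD, Λ.d_one]

lemma rightDerivLoc_one (hω : ω 1 = 0) : rightDerivLoc ω 1 = 0 := by
  rw [← map_one fbr, rightDerivLoc_fib, rightFibreDeriv, LinearMap.add_apply, convOp_comul_one, hω]
  simp [fibD, Λ.d_one]

lemma leftDerivLoc_mem_horLoc
    (hω : ∀ h, leftFibreDeriv ω h ∈ horLoc Γ Λ.toDifferentialCalculus) {x : L}
    (hx : x ∈ horLoc Γ Λ.toDifferentialCalculus) :
    leftDerivLoc ω x ∈ horLoc Γ Λ.toDifferentialCalculus := by
  induction hx using horLoc_induction with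
  | zero => simp
  | add x y _ _ hx hy => rw [map_add]; exact add_mem hx hy
  | mul _ a h _ _ =>
    rw [leftDerivLoc_inl_mul_fib]
    exact add_mem (mul_mem (inl_mem_horLoc _) (fib_mem_horLoc _))
      (mul_mem (inl_mem_horLoc _) (hω h))

lemma rightDerivLoc_mem_horLoc
    (hω : ∀ h, rightFibreDeriv ω h ∈ horLoc Γ Λ.toDifferentialCalculus) {x : L}
    (hx : x ∈ horLoc Γ Λ.toDifferentialCalculus) :
    rightDerivLoc ω x ∈ horLoc Γ Λ.toDifferentialCalculus := by
  induction hx using horLoc_induction with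
  | zero => simp
  | add x y _ _ hx hy => rw [map_add]; exact add_mem hx hy
  | mul _ a h _ _ =>
    rw [rightDerivLoc_inl_mul_fib]
    exact add_mem (mul_mem (inl_mem_horLoc _) (fib_mem_horLoc _))
      (mul_mem (hω h) (inl_mem_horLoc _))

lemma isEquivariant_leftFibreDeriv_iff :
    IsEquivariant comul (coactLoc Γ Λ) (leftFibreDeriv ω) ↔
      IsEquivariant (adL H) (coactLoc Γ Λ) ω := by
  refine Iff.trans
    ⟨fun h => add_sub_cancel_left (fibD Γ Λ) (conv comul (fbr).toLinearMap ω) ▸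
      h.sub isEquivariant_fibD, isEquivariant_fibD.add⟩
    (isEquivariant_conv_iff (ρ := coactLocHom Γ Λ) isEquivariant_fib ω)

lemma isEquivariant_rightFibreDeriv_iff
    (hS : Function.Bijective (HopfAlgebra.antipode ℂ : H →ₗ[ℂ] H)) :
    IsEquivariant comul (coactLoc Γ Λ) (rightFibreDeriv ω) ↔
      IsEquivariant (adR H hS) (coactLoc Γ Λ) ω := by
  refine Iff.trans
    ⟨fun h => add_sub_cancel_left (fibD Γ Λ) (convOp comul (fbr).toLinearMap ω) ▸
      h.sub isEquivariant_fibD, isEquivariant_fibD.add⟩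
    (isEquivariant_convOp_iff (ρ := coactLocHom Γ Λ) hS isEquivariant_fib ω)

lemma coactLoc_leftDerivLoc (hω : IsEquivariant (adL H) (coactLoc Γ Λ) ω) {x : L}
    (hx : x ∈ horLoc Γ Λ.toDifferentialCalculus) :
    coactLoc Γ Λ (leftDerivLoc ω x) = LinearMap.rTensor H (leftDerivLoc ω) (coactLoc Γ Λ x) := by
  refine coactLoc_comm_of_isEquivariant (fun a => ?_) hx
  convert (isEquivariant_fib.inl_mul (Γ.d a)).add
    ((isEquivariant_leftFibreDeriv_iff.2 hω).inl_mul (Γ.parity a)) using 1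
  exact LinearMap.ext (leftDerivLoc_inl_mul_fib ω a)

lemma coactLoc_rightDerivLoc {hS : Function.Bijective (HopfAlgebra.antipode ℂ : H →ₗ[ℂ] H)}
    (hω : IsEquivariant (adR H hS) (coactLoc Γ Λ) ω) {x : L}
    (hx : x ∈ horLoc Γ Λ.toDifferentialCalculus) :
    coactLoc Γ Λ (rightDerivLoc ω x) = LinearMap.rTensor H (rightDerivLoc ω) (coactLoc Γ Λ x) := by
  refine coactLoc_comm_of_isEquivariant (fun a => ?_) hx
  convert (isEquivariant_fib.inl_mul (Γ.d a)).add
    (((isEquivariant_rightFibreDeriv_iff hS).2 hω).mul_inl a) using 1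
  exact LinearMap.ext (rightDerivLoc_inl_mul_fib ω a)

lemma leftDerivLoc_mem_skewGr {n : ℕ} (hω : ∀ h, ω h ∈ skewGr Γ Λ.toDifferentialCalculus 1) {x : L}
    (hx : x ∈ skewGr Γ Λ.toDifferentialCalculus n) :
    leftDerivLoc ω x ∈ skewGr Γ Λ.toDifferentialCalculus (n + 1) := by
  rw [leftDerivLoc, LinearMap.add_apply, LinearMap.comp_apply, parityLoc_of_mem hx, map_smul]
  exact add_mem (skewD_mem hx) (Submodule.smul_mem _ _
    (conv_apply_mem (coactLoc_mem_skewGr hx) fun v hv h => skewGr_mul hv (hω h)))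

lemma rightDerivLoc_mem_skewGr {n : ℕ} (hω : ∀ h, ω h ∈ skewGr Γ Λ.toDifferentialCalculus 1)
    {x : L} (hx : x ∈ skewGr Γ Λ.toDifferentialCalculus n) :
    rightDerivLoc ω x ∈ skewGr Γ Λ.toDifferentialCalculus (n + 1) := by
  rw [rightDerivLoc, LinearMap.add_apply]
  exact add_mem (skewD_mem hx) (convOp_apply_mem (coactLoc_mem_skewGr hx) fun v hv h =>
    add_comm 1 n ▸ skewGr_mul (hω h) hv)

lemma leftDerivLoc_inl_mul {n : ℕ} {a : Γ.carrier} (ha : a ∈ Γ.gr n) {x : L}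
    (hx : x ∈ horLoc Γ Λ.toDifferentialCalculus) :
    leftDerivLoc ω (lft a * x) =
      lft (Γ.d a) * x + (-1 : ℂ) ^ n • (lft a * leftDerivLoc ω x) := by
  induction hx using horLoc_induction with
  | zero => simp
  | add x y _ _ hx hy =>
    simp only [mul_add, map_add, smul_add, hx, hy]
    abel
  | mul m b h hb _ =>
    rw [← mul_assoc, ← map_mul lft, leftDerivLoc_inl_mul_fib, leftDerivLoc_inl_mul_fib,
      Γ.leibniz ha, Γ.parity_of_mem hb, Γ.parity_of_mem (SetLike.mul_mem_graded ha hb)]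
    simp only [map_add, map_smul, map_mul, add_mul, mul_add, smul_mul_assoc, mul_smul_comm,
      mul_assoc, smul_add, smul_smul, pow_add, add_assoc]

lemma rightDerivLoc_mul_inl (a : Γ.carrier) {x : L}
    (hx : x ∈ horLoc Γ Λ.toDifferentialCalculus) :
    rightDerivLoc ω (x * lft a) =
      rightDerivLoc ω x * lft a + parityLoc Γ Λ.toDifferentialCalculus x * lft (Γ.d a) := by
  induction hx using horLoc_induction with
  | zero => simp
  | add x y _ _ hx hy =>
    simp only [add_mul, map_add, hx, hy]
    abel
  | mul m b h hb _ =>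
    rw [mul_assoc, fib_mul_inl, ← mul_assoc, ← map_mul lft, rightDerivLoc_inl_mul_fib,
      rightDerivLoc_inl_mul_fib, parityLoc_inl_mul_fib, Γ.leibniz hb, Γ.parity_of_mem hb]
    simp only [map_add, map_smul, map_mul, add_mul, smul_mul_assoc, mul_assoc, fib_mul_inl]
    abel

/-! ### Vertical parts -/

lemma vertC_leftFibreDeriv (h : H) :
    vertC Γ Λ.toDifferentialCalculus (leftFibreDeriv ω h) =
      fibD Γ Λ h + convEquiv fbr (vertC Γ Λ.toDifferentialCalculus ∘ₗ ω) h := by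
  rw [leftFibreDeriv, LinearMap.add_apply, map_add, convEquiv_apply]
  exact congrArg₂ (· + ·) (vertC_inr_d h)
    (LinearMap.congr_fun (comp_conv_of_mul (f := (fbr).toLinearMap) vertC_fib_mul ω) h)

lemma vertC_rightFibreDeriv (hS : Function.Bijective (HopfAlgebra.antipode ℂ : H →ₗ[ℂ] H))
    (h : H) :
    vertC Γ Λ.toDifferentialCalculus (rightFibreDeriv ω h) =
      fibD Γ Λ h + convOpEquiv hS fbr (vertC Γ Λ.toDifferentialCalculus ∘ₗ ω) h := by
  rw [rightFibreDeriv, LinearMap.add_apply, map_add, convOpEquiv_apply]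
  exact congrArg₂ (· + ·) (vertC_inr_d h)
    (LinearMap.congr_fun (comp_convOp_of_mul (f := (fbr).toLinearMap)
      (fun h x => vertC_mul_fib h x) ω) h)

lemma inr_comp_vertL :
    (inr Γ Λ.toDifferentialCalculus).toLinearMap ∘ₗ vertL Λ = (convEquiv fbr).symm (fibD Γ Λ) := by
  rw [convEquiv_symm_apply]
  exact algHom_comp_conv _ _ _

lemma inr_comp_vertR (hS : Function.Bijective (HopfAlgebra.antipode ℂ : H →ₗ[ℂ] H)) :
    (inr Γ Λ.toDifferentialCalculus).toLinearMap ∘ₗ vertR Λ hS =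
      (convOpEquiv hS fbr).symm (fibD Γ Λ) := by
  rw [convOpEquiv_symm_apply]
  exact algHom_comp_convOp _ _ _

lemma vertC_comp_eq_neg_vertL_iff :
    vertC Γ Λ.toDifferentialCalculus ∘ₗ ω =
        -((inr Γ Λ.toDifferentialCalculus).toLinearMap ∘ₗ vertL Λ) ↔
      ∀ h, leftFibreDeriv ω h ∈ horLoc Γ Λ.toDifferentialCalculus := by
  rw [inr_comp_vertL, ← map_neg, LinearEquiv.eq_symm_apply, eq_neg_iff_add_eq_zero,
    add_comm, LinearMap.ext_iff]
  simp only [← vertC_eq_zero_iff, vertC_leftFibreDeriv, LinearMap.add_apply, LinearMap.zero_apply]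

lemma vertC_comp_eq_neg_vertR_iff
    (hS : Function.Bijective (HopfAlgebra.antipode ℂ : H →ₗ[ℂ] H)) :
    vertC Γ Λ.toDifferentialCalculus ∘ₗ ω =
        -((inr Γ Λ.toDifferentialCalculus).toLinearMap ∘ₗ vertR Λ hS) ↔
      ∀ h, rightFibreDeriv ω h ∈ horLoc Γ Λ.toDifferentialCalculus := by
  rw [inr_comp_vertR, ← map_neg, LinearEquiv.eq_symm_apply, eq_neg_iff_add_eq_zero,
    add_comm, LinearMap.ext_iff]
  simp only [← vertC_eq_zero_iff, vertC_rightFibreDeriv hS, LinearMap.add_apply,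
    LinearMap.zero_apply]

/-! ### Recovering the form from the values on the fibre -/

variable (Γ Λ) in
/-- The correspondence between local forms and the values of their left derivatives on the
fibre. -/
def leftFibreEquiv : (H →ₗ[ℂ] L) ≃ (H →ₗ[ℂ] L) :=
  (convEquiv fbr).toEquiv.trans (Equiv.addLeft (fibD Γ Λ))

lemma leftFibreDeriv_symm (φ : H →ₗ[ℂ] L) : leftFibreDeriv ((leftFibreEquiv Γ Λ).symm φ) = φ :=
  (leftFibreEquiv Γ Λ).apply_symm_apply φ

variable (Γ Λ) in
/-- The correspondence between local forms and the values of their right derivatives on the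
fibre. -/
def rightFibreEquiv (hS : Function.Bijective (HopfAlgebra.antipode ℂ : H →ₗ[ℂ] H)) :
    (H →ₗ[ℂ] L) ≃ (H →ₗ[ℂ] L) :=
  (convOpEquiv hS fbr).toEquiv.trans (Equiv.addLeft (fibD Γ Λ))

lemma rightFibreDeriv_symm (hS : Function.Bijective (HopfAlgebra.antipode ℂ : H →ₗ[ℂ] H))
    (φ : H →ₗ[ℂ] L) : rightFibreDeriv ((rightFibreEquiv Γ Λ hS).symm φ) = φ :=
  (rightFibreEquiv Γ Λ hS).apply_symm_apply φ

lemma fibD_mem_skewGr (h : H) : fibD Γ Λ h ∈ skewGr Γ Λ.toDifferentialCalculus 1 :=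
  skewTmul_mem (p := 0) (q := 1) Γ.one_mem_gr (Λ.d_mem (Λ.of_mem h))

variable {φ : H →ₗ[ℂ] Skew Γ Λ.toDifferentialCalculus}

lemma leftFibreEquiv_symm_one (hφ : φ 1 = 0) : (leftFibreEquiv Γ Λ).symm φ 1 = 0 := by
  change (convEquiv fbr).symm (-fibD Γ Λ + φ) 1 = 0
  rw [convEquiv_symm_apply, conv_comul_one, LinearMap.add_apply, hφ]
  simp [fibD, Λ.d_one]

lemma rightFibreEquiv_symm_one (hS : Function.Bijective (HopfAlgebra.antipode ℂ : H →ₗ[ℂ] H))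
    (hφ : φ 1 = 0) : (rightFibreEquiv Γ Λ hS).symm φ 1 = 0 := by
  change (convOpEquiv hS fbr).symm (-fibD Γ Λ + φ) 1 = 0
  rw [convOpEquiv_symm_apply, convOp_comul_one, LinearMap.add_apply, hφ]
  simp [fibD, Λ.d_one]

lemma leftFibreEquiv_symm_mem_skewGr (hφ : ∀ h, φ h ∈ skewGr Γ Λ.toDifferentialCalculus 1)
    (h : H) : (leftFibreEquiv Γ Λ).symm φ h ∈ skewGr Γ Λ.toDifferentialCalculus 1 := by
  change (convEquiv fbr).symm (-fibD Γ Λ + φ) h ∈ _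
  rw [convEquiv_symm_apply]
  exact conv_apply_mem (X := ⊤) (LinearMap.rTensor_surjective H Submodule.topEquiv.surjective _)
    fun v _ h => skewGr_mul (m := 0) (n := 1)
      (fib_mem_skewGr (HopfAlgebra.antipode ℂ v))
      (add_mem (neg_mem (fibD_mem_skewGr h)) (hφ h))

lemma rightFibreEquiv_symm_mem_skewGr
    (hS : Function.Bijective (HopfAlgebra.antipode ℂ : H →ₗ[ℂ] H))
    (hφ : ∀ h, φ h ∈ skewGr Γ Λ.toDifferentialCalculus 1)
    (h : H) : (rightFibreEquiv Γ Λ hS).symm φ h ∈ skewGr Γ Λ.toDifferentialCalculus 1 := by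
  change (convOpEquiv hS fbr).symm (-fibD Γ Λ + φ) h ∈ _
  rw [convOpEquiv_symm_apply]
  exact convOp_apply_mem (X := ⊤) (LinearMap.rTensor_surjective H Submodule.topEquiv.surjective _)
    fun v _ h => skewGr_mul (m := 1) (n := 0) (add_mem (neg_mem (fibD_mem_skewGr h)) (hφ h))
      (fib_mem_skewGr (antipodeInv H hS v))

variable (Γ Λ) in
/-- The properties of the values `h ↦ D(1 ⊗ h)` of a left or right covariant derivative over one
trivialization. -/
structure IsFibreDeriv (φ : H →ₗ[ℂ] L) : Prop where
  degree : ∀ h, φ h ∈ skewGr Γ Λ.toDifferentialCalculus 1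
  map_one : φ 1 = 0
  equivariant : IsEquivariant comul (coactLoc Γ Λ) φ
  horizontal : ∀ h, φ h ∈ horLoc Γ Λ.toDifferentialCalculus

lemma isFibreDeriv_leftFibreDeriv_iff :
    IsFibreDeriv Γ Λ (leftFibreDeriv ω) ↔
      (∀ h, ω h ∈ skewGr Γ Λ.toDifferentialCalculus 1) ∧ ω 1 = 0 ∧
        IsEquivariant (adL H) (coactLoc Γ Λ) ω ∧
        vertC Γ Λ.toDifferentialCalculus ∘ₗ ω =
          -((inr Γ Λ.toDifferentialCalculus).toLinearMap ∘ₗ vertL Λ) := by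
  have hsymm : (leftFibreEquiv Γ Λ).symm (leftFibreDeriv ω) = ω := Equiv.symm_apply_apply _ ω
  constructor
  · intro hφ
    refine ⟨fun h => ?_, ?_, isEquivariant_leftFibreDeriv_iff.1 hφ.equivariant,
      vertC_comp_eq_neg_vertL_iff.2 hφ.horizontal⟩
    · simpa only [hsymm] using leftFibreEquiv_symm_mem_skewGr hφ.degree h
    · simpa only [hsymm] using leftFibreEquiv_symm_one hφ.map_one
  · rintro ⟨hdeg, hone, hequiv, hvert⟩
    exact {
      degree h := leftDerivLoc_fib (ω := ω) h ▸ leftDerivLoc_mem_skewGr hdeg (fib_mem_skewGr h)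
      map_one := by rw [← leftDerivLoc_fib, map_one, leftDerivLoc_one hone]
      equivariant := isEquivariant_leftFibreDeriv_iff.2 hequiv
      horizontal := vertC_comp_eq_neg_vertL_iff.1 hvert }

lemma isFibreDeriv_rightFibreDeriv_iff
    (hS : Function.Bijective (HopfAlgebra.antipode ℂ : H →ₗ[ℂ] H)) :
    IsFibreDeriv Γ Λ (rightFibreDeriv ω) ↔
      (∀ h, ω h ∈ skewGr Γ Λ.toDifferentialCalculus 1) ∧ ω 1 = 0 ∧
        IsEquivariant (adR H hS) (coactLoc Γ Λ) ω ∧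
        vertC Γ Λ.toDifferentialCalculus ∘ₗ ω =
          -((inr Γ Λ.toDifferentialCalculus).toLinearMap ∘ₗ vertR Λ hS) := by
  have hsymm : (rightFibreEquiv Γ Λ hS).symm (rightFibreDeriv ω) = ω :=
    Equiv.symm_apply_apply _ ω
  constructor
  · intro hφ
    refine ⟨fun h => ?_, ?_, (isEquivariant_rightFibreDeriv_iff hS).1 hφ.equivariant,
      (vertC_comp_eq_neg_vertR_iff hS).2 hφ.horizontal⟩
    · simpa only [hsymm] using rightFibreEquiv_symm_mem_skewGr hS hφ.degree h
    · simpa only [hsymm] using rightFibreEquiv_symm_one hS hφ.map_one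
  · rintro ⟨hdeg, hone, hequiv, hvert⟩
    exact {
      degree h := rightDerivLoc_fib (ω := ω) h ▸ rightDerivLoc_mem_skewGr hdeg (fib_mem_skewGr h)
      map_one := by rw [← rightDerivLoc_fib, map_one, rightDerivLoc_one hone]
      equivariant := (isEquivariant_rightFibreDeriv_iff hS).2 hequiv
      horizontal := (vertC_comp_eq_neg_vertR_iff hS).1 hvert }

end Local

/-! ### Glueing along overlaps -/

section Glueing

lemma isTwoSided_sup {A : Type*} [Ring A] (K K' : Ideal A) [K.IsTwoSided] [K'.IsTwoSided] :
    (K ⊔ K').IsTwoSided where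
  mul_mem_of_left {a} b ha := by
    obtain ⟨x, hx, y, hy, rfl⟩ := Submodule.mem_sup.1 ha
    rw [add_mul]
    exact Submodule.add_mem_sup (K.mul_mem_right b hx) (K'.mul_mem_right b hy)

variable {A L₁ L₂ : Type*} [Ring A] [Algebra ℂ A] [Ring L₁] [Algebra ℂ L₁] [Ring L₂] [Algebra ℂ L₂]

lemma exists_comp_eq_mkₐ {f : A →ₐ[ℂ] L₁} (hf : Function.Surjective f) {K : Ideal A}
    [K.IsTwoSided] (hK : RingHom.ker f ≤ K) :
    ∃ q : L₁ →ₐ[ℂ] A ⧸ K, q.comp f = Ideal.Quotient.mkₐ ℂ K :=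
  ⟨(Ideal.Quotient.factorₐ ℂ hK).comp (Ideal.quotientKerAlgEquivOfSurjective hf).symm.toAlgHom,
    AlgHom.ext fun x => congrArg (Ideal.Quotient.factorₐ ℂ hK)
      ((Ideal.quotientKerAlgEquivOfSurjective hf).symm_apply_apply (Ideal.Quotient.mk _ x))⟩

lemma exists_compatible_iff {I : Type*} {L : I → Type*} [∀ i, Ring (L i)] [∀ i, Algebra ℂ (L i)]
    {p : ∀ i, A →ₐ[ℂ] L i} (hp : ∀ i, Function.Surjective (p i)) (i j : I) :
    ∃ (K : Ideal A) (_ : K.IsTwoSided) (q₁ : L i →ₐ[ℂ] A ⧸ K) (q₂ : L j →ₐ[ℂ] A ⧸ K),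
      ∀ a b, Compatible p i j a b ↔ q₁ a = q₂ b := by
  have hK := isTwoSided_sup (RingHom.ker (p i)) (RingHom.ker (p j))
  obtain ⟨q₁, hq₁⟩ := exists_comp_eq_mkₐ (hp i)
    (le_sup_left : _ ≤ RingHom.ker (p i) ⊔ RingHom.ker (p j))
  obtain ⟨q₂, hq₂⟩ := exists_comp_eq_mkₐ (hp j)
    (le_sup_right : _ ≤ RingHom.ker (p i) ⊔ RingHom.ker (p j))
  have hq (x y) : q₁ (p i x) = q₂ (p j y) ↔ x - y ∈ RingHom.ker (p i) ⊔ RingHom.ker (p j) := by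
    rw [← AlgHom.comp_apply, hq₁, ← AlgHom.comp_apply, hq₂]
    exact Ideal.Quotient.eq
  refine ⟨_, hK, q₁, q₂, fun a b => ⟨?_, fun h => ?_⟩⟩
  · rintro ⟨x, y, rfl, rfl, hxy⟩
    exact (hq x y).2 hxy
  · obtain ⟨x, rfl⟩ := hp i a
    obtain ⟨y, rfl⟩ := hp j b
    exact ⟨x, y, rfl, rfl, (hq x y).1 h⟩

variable {V H : Type*} [AddCommGroup V] [Module ℂ V] [Ring H] [HopfAlgebra ℂ H]
variable {Q : Type*} [Ring Q] [Algebra ℂ Q] {q₁ : L₁ →ₐ[ℂ] Q} {q₂ : L₂ →ₐ[ℂ] Q}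
variable {δ : V →ₗ[ℂ] V ⊗[ℂ] H} {δ₁ : L₁ →ₗ[ℂ] L₁ ⊗[ℂ] H} {f₁ : V →ₗ[ℂ] L₁} {f₂ : V →ₗ[ℂ] L₂}
variable {j : H →ₐ[ℂ] L₁} {ω₁ : H →ₗ[ℂ] L₁} {ω₂ : H →ₗ[ℂ] L₂}

open Coalgebra

/-- Since `j` can be cancelled, forms agree as soon as their convolutions agree on elements of `V`
lying over the image of `j`. -/
lemma algHom_comp_eq_of_conv (hf : q₁.toLinearMap ∘ₗ f₁ = q₂.toLinearMap ∘ₗ f₂)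
    (hf₁ : IsEquivariant δ δ₁ f₁) (hj : IsEquivariant comul δ₁ j.toLinearMap)
    (hlift : ∀ h, ∃ v, f₁ v = j h ∧ q₁ (conv δ f₁ ω₁ v) = q₂ (conv δ f₂ ω₂ v)) :
    q₁.toLinearMap ∘ₗ ω₁ = q₂.toLinearMap ∘ₗ ω₂ := by
  refine (convEquiv (q₁.comp j)).injective (LinearMap.ext fun h => ?_)
  obtain ⟨v, hv, hω⟩ := hlift h
  have key (g : H →ₗ[ℂ] Q) :
      convEquiv (q₁.comp j) g h = conv δ (q₁.toLinearMap ∘ₗ f₁) g v := by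
    rw [← hf₁.conv_comp, LinearMap.comp_apply, hv]
    exact (LinearMap.congr_fun (hj.conv_comp q₁.toLinearMap g) h).symm
  rw [key, key, ← algHom_comp_conv, hf, ← algHom_comp_conv]
  exact hω

lemma algHom_comp_eq_of_convOp (hS : Function.Bijective (HopfAlgebra.antipode ℂ : H →ₗ[ℂ] H))
    (hf : q₁.toLinearMap ∘ₗ f₁ = q₂.toLinearMap ∘ₗ f₂)
    (hf₁ : IsEquivariant δ δ₁ f₁) (hj : IsEquivariant comul δ₁ j.toLinearMap)
    (hlift : ∀ h, ∃ v, f₁ v = j h ∧ q₁ (convOp δ f₁ ω₁ v) = q₂ (convOp δ f₂ ω₂ v)) :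
    q₁.toLinearMap ∘ₗ ω₁ = q₂.toLinearMap ∘ₗ ω₂ := by
  refine (convOpEquiv hS (q₁.comp j)).injective (LinearMap.ext fun h => ?_)
  obtain ⟨v, hv, hω⟩ := hlift h
  have key (g : H →ₗ[ℂ] Q) :
      convOpEquiv hS (q₁.comp j) g h = convOp δ (q₁.toLinearMap ∘ₗ f₁) g v := by
    rw [← hf₁.convOp_comp, LinearMap.comp_apply, hv]
    exact (LinearMap.congr_fun (hj.convOp_comp q₁.toLinearMap g) h).symm
  rw [key, key, ← algHom_comp_convOp, hf, ← algHom_comp_convOp]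
  exact hω

section Compatible

variable {I : Type*} {L : I → Type*} [∀ i, Ring (L i)] [∀ i, Algebra ℂ (L i)]
  {p : ∀ i, A →ₐ[ℂ] L i} {i i' : I} {δ₁ : L i →ₗ[ℂ] L i ⊗[ℂ] H} {f₁ : V →ₗ[ℂ] L i}
  {f₂ : V →ₗ[ℂ] L i'} {j : H →ₐ[ℂ] L i} {ω₁ : H →ₗ[ℂ] L i} {ω₂ : H →ₗ[ℂ] L i'}

lemma compatible_of_conv (hp : ∀ i, Function.Surjective (p i))
    (hf : ∀ v, Compatible p i i' (f₁ v) (f₂ v)) (hf₁ : IsEquivariant δ δ₁ f₁)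
    (hj : IsEquivariant comul δ₁ j.toLinearMap)
    (hlift : ∀ h, ∃ v, f₁ v = j h ∧ Compatible p i i' (conv δ f₁ ω₁ v) (conv δ f₂ ω₂ v)) (h : H) :
    Compatible p i i' (ω₁ h) (ω₂ h) := by
  obtain ⟨K, _, q₁, q₂, hq⟩ := exists_compatible_iff hp i i'
  simp only [hq] at hf hlift ⊢
  exact LinearMap.congr_fun (algHom_comp_eq_of_conv (LinearMap.ext hf) hf₁ hj hlift) h

lemma compatible_of_convOp (hS : Function.Bijective (HopfAlgebra.antipode ℂ : H →ₗ[ℂ] H))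
    (hp : ∀ i, Function.Surjective (p i))
    (hf : ∀ v, Compatible p i i' (f₁ v) (f₂ v)) (hf₁ : IsEquivariant δ δ₁ f₁)
    (hj : IsEquivariant comul δ₁ j.toLinearMap)
    (hlift : ∀ h, ∃ v, f₁ v = j h ∧ Compatible p i i' (convOp δ f₁ ω₁ v) (convOp δ f₂ ω₂ v))
    (h : H) : Compatible p i i' (ω₁ h) (ω₂ h) := by
  obtain ⟨K, _, q₁, q₂, hq⟩ := exists_compatible_iff hp i i'
  simp only [hq] at hf hlift ⊢
  exact LinearMap.congr_fun (algHom_comp_eq_of_convOp hS (LinearMap.ext hf) hf₁ hj hlift) h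

end Compatible

end Glueing

/-! ### Global forms -/

lemma decompose_map {ι R V W : Type*} [DecidableEq ι] [Ring R] [AddCommGroup V] [Module R V]
    [AddCommGroup W] [Module R W] (𝒱 : ι → Submodule R V) (𝒲 : ι → Submodule R W)
    [DirectSum.Decomposition 𝒱] [DirectSum.Decomposition 𝒲] {f : V →ₗ[R] W}
    (hf : ∀ n x, x ∈ 𝒱 n → f x ∈ 𝒲 n) (n : ι) (x : V) :
    f (DirectSum.decompose 𝒱 x n) = DirectSum.decompose 𝒲 (f x) n := by
  induction x using DirectSum.Decomposition.inductionOn 𝒱 with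
  | zero => simp
  | add x y hx hy => simp [DirectSum.decompose_add, hx, hy]
  | @homogeneous m x =>
    by_cases h : m = n
    · subst h
      rw [DirectSum.decompose_of_mem_same _ x.2, DirectSum.decompose_of_mem_same _ (hf _ _ x.2)]
    · rw [DirectSum.decompose_of_mem_ne _ x.2 h, DirectSum.decompose_of_mem_ne _ (hf _ _ x.2) h,
        map_zero]

namespace DifferentialStructure

variable {I P B H : Type*} [Ring P] [Algebra ℂ P] [Ring B] [Algebra ℂ B] [Ring H] [HopfAlgebra ℂ H]
variable {E : LocallyTrivialBundle I P B H} (S : DifferentialStructure E)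

/-- The inclusion `Γ(B_i) → Γ(B_i) ⊗̂ Γ(H)`. -/
abbrev inlAt (i : I) : (S.ΓB i).carrier →ₐ[ℂ] S.Loc i := inl (S.ΓB i) S.ΓH.toDifferentialCalculus

/-- The inclusion `H → Γ(B_i) ⊗̂ Γ(H)`. -/
abbrev fibAt (i : I) : H →ₐ[ℂ] S.Loc i := fib (S.ΓB i) S.ΓH.toDifferentialCalculus

/-- The map `χ_i` on `hor Γ_c(P)`. -/
abbrev evalHor (i : I) : S.hor →ₗ[ℂ] S.Loc i := LinearMap.proj i ∘ₗ S.hor.val.toLinearMap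

/-- The map `χ_i` on `Γ_c(P)`. -/
abbrev evalC (i : I) : S.gammaC →ₗ[ℂ] S.Loc i := LinearMap.proj i ∘ₗ S.gammaC.val.toLinearMap

lemma skewOf_one_tmul (i : I) (h : H) :
    skewOf (S.ΓB i) S.ΓH.toDifferentialCalculus (1 ⊗ₜ h) = S.fibAt i h := by
  simp [skewOf, fib_apply, skewTmul]

lemma skewOf_tmul_one (i : I) (b : B ⧸ E.J i) :
    skewOf (S.ΓB i) S.ΓH.toDifferentialCalculus (b ⊗ₜ 1) = S.inlAt i ((S.ΓB i).of b) := by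
  simp [skewOf, inl_apply, skewTmul]

lemma πΓ_surjective (i : I) : Function.Surjective (S.πΓ i) := by
  rw [← AlgHom.range_eq_top, ← top_le_iff, ← (S.ΓB i).generated, Algebra.adjoin_le_iff]
  rintro _ (⟨b, rfl⟩ | ⟨b, rfl⟩) <;> obtain ⟨b, rfl⟩ := Ideal.Quotient.mk_surjective b
  · exact ⟨S.ΓBase.of b, S.πΓ_of i b⟩
  · exact ⟨S.ΓBase.d (S.ΓBase.of b), (S.πΓ_d i _).trans (congrArg _ (S.πΓ_of i b))⟩

lemma exists_base_form (i : I) {n : ℕ} {a : (S.ΓB i).carrier} (ha : a ∈ (S.ΓB i).gr n) :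
    ∃ ρ : S.gammaCBase, ρ.1 ∈ S.gradeBase n ∧ ρ.1 i = a := by
  obtain ⟨x, rfl⟩ := S.πΓ_surjective i a
  refine ⟨⟨fun j => S.πΓ j (DirectSum.decompose S.ΓBase.gr x n),
    (mem_coveringCompletion _ _).2 fun j k => ⟨_, rfl, rfl⟩⟩,
    fun j _ => S.πΓ_mem j n _ (Subtype.prop _), ?_⟩
  exact (decompose_map S.ΓBase.gr (S.ΓB i).gr (f := (S.πΓ i).toLinearMap) (S.πΓ_mem i) n x).trans
    (DirectSum.decompose_of_mem_same _ ha)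

lemma skewOf_mem_range_χΓ (i : I) (t : (B ⧸ E.J i) ⊗[ℂ] H) :
    skewOf (S.ΓB i) S.ΓH.toDifferentialCalculus t ∈ (S.χΓ i).range := by
  obtain ⟨x, rfl⟩ := E.χ_surjective i t
  exact ⟨S.ΓP.of x, S.χΓ_of i x⟩

lemma skewD_mem_range_χΓ {i : I} {x : S.Loc i} (hx : x ∈ (S.χΓ i).range) :
    skewD (S.ΓB i) S.ΓH.toDifferentialCalculus x ∈ (S.χΓ i).range := by
  obtain ⟨y, rfl⟩ := hx
  exact ⟨S.ΓP.d y, S.χΓ_d i y⟩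

lemma inlAt_mem_range_χΓ (i : I) (a : (S.ΓB i).carrier) : S.inlAt i a ∈ (S.χΓ i).range := by
  suffices (S.χΓ i).range.comap (S.inlAt i) = ⊤ from this.ge trivial
  have hof (b) : S.inlAt i ((S.ΓB i).of b) ∈ (S.χΓ i).range :=
    S.skewOf_tmul_one i b ▸ S.skewOf_mem_range_χΓ i _
  rw [← top_le_iff, ← (S.ΓB i).generated, Algebra.adjoin_le_iff]
  rintro _ (⟨b, rfl⟩ | ⟨b, rfl⟩)
  · exact hof b
  · exact (skewD_inl _).subst (motive := (· ∈ (S.χΓ i).range)) (S.skewD_mem_range_χΓ (hof b))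

lemma inr_mem_range_χΓ (i : I) (b : S.ΓH.carrier) :
    inr (S.ΓB i) S.ΓH.toDifferentialCalculus b ∈ (S.χΓ i).range := by
  suffices (S.χΓ i).range.comap (inr (S.ΓB i) S.ΓH.toDifferentialCalculus) = ⊤ from
    this.ge trivial
  have hof (h) : S.fibAt i h ∈ (S.χΓ i).range :=
    S.skewOf_one_tmul i h ▸ S.skewOf_mem_range_χΓ i _
  rw [← top_le_iff, ← S.ΓH.generated, Algebra.adjoin_le_iff]
  rintro _ (⟨h, rfl⟩ | ⟨h, rfl⟩)
  · exact hof h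
  · exact (skewD_inr _).subst (motive := (· ∈ (S.χΓ i).range)) (S.skewD_mem_range_χΓ (hof h))

lemma χΓ_surjective (i : I) : Function.Surjective (S.χΓ i) := by
  rw [← AlgHom.range_eq_top, eq_top_iff]
  intro x _
  induction x using skewTmul_induction with
  | zero => exact zero_mem _
  | add x y hx hy => exact add_mem (hx trivial) (hy trivial)
  | tmul _ _ a b _ _ =>
    rw [← inl_mul_inr]
    exact mul_mem (S.inlAt_mem_range_χΓ i a) (S.inr_mem_range_χΓ i b)

/-- The embedding of `P` into `hor Γ_c(P)`. -/
def ofTotal : P →ₗ[ℂ] S.hor :=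
  LinearMap.codRestrict (Subalgebra.toSubmodule S.hor)
    (LinearMap.pi fun i => (S.χΓ i).toLinearMap ∘ₗ S.ΓP.of.toLinearMap) fun p =>
    ⟨(mem_coveringCompletion _ _).2 fun _ _ => ⟨_, rfl, rfl⟩, fun i _ =>
      (congrArg (· ∈ horLoc _ _) (S.χΓ_of i p)).mpr (skewOf_mem_horLoc _)⟩

/-- A linear choice of horizontal forms of degree zero lying over the elements `1 ⊗ h` of the
`i`-th trivialization. -/
def fibLift (i : I) : H →ₗ[ℂ] S.hor :=
  S.ofTotal ∘ₗ
    ((E.χ i).toLinearMap.exists_rightInverse_of_surjective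
      (LinearMap.range_eq_top.2 (E.χ_surjective i))).choose ∘ₗ
    TensorProduct.mk ℂ (B ⧸ E.J i) H 1

lemma fibLift_apply_self (i : I) (h : H) : (S.fibLift i h).1 i = S.fibAt i h := by
  rw [← skewOf_one_tmul]
  exact (S.χΓ_of i _).trans (congrArg _ (LinearMap.congr_fun
    ((E.χ i).toLinearMap.exists_rightInverse_of_surjective
      (LinearMap.range_eq_top.2 (E.χ_surjective i))).choose_spec (1 ⊗ₜ h)))

lemma fibLift_mem_gradeTot (i : I) (h : H) : (S.fibLift i h).1 ∈ S.gradeTot 0 :=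
  fun k _ => S.χΓ_mem k 0 _ (S.ΓP.of_mem _)

lemma χΓ_parity (i : I) (x : S.ΓP.carrier) :
    S.χΓ i (S.ΓP.parity x) = parityLoc (S.ΓB i) S.ΓH.toDifferentialCalculus (S.χΓ i x) := by
  induction x using DirectSum.Decomposition.inductionOn S.ΓP.gr with
  | zero => simp
  | add x y hx hy => simp only [map_add, hx, hy]
  | @homogeneous n x =>
    rw [S.ΓP.parity_of_mem x.2, map_smul, parityLoc_of_mem (S.χΓ_mem i n _ x.2)]

/-- The operator `γ ↦ (-1)^n γ`, `γ` of degree `n`, on horizontal forms. -/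
def parityHor : S.hor →ₗ[ℂ] S.hor :=
  LinearMap.codRestrict (Subalgebra.toSubmodule S.hor)
    (LinearMap.pi fun i => parityLoc (S.ΓB i) S.ΓH.toDifferentialCalculus ∘ₗ S.evalHor i)
    fun γ => ⟨(mem_coveringCompletion _ _).2 fun i j =>
      have ⟨x, hi, hj⟩ := (mem_coveringCompletion _ _).1 γ.2.1 i j
      ⟨S.ΓP.parity x, (S.χΓ_parity i x).trans (congrArg _ hi),
        (S.χΓ_parity j x).trans (congrArg _ hj)⟩,
      fun i _ => parityLoc_mem_horLoc (γ.2.2 i trivial)⟩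

lemma parityHor_of_mem {n : ℕ} {γ : S.hor} (hγ : γ.1 ∈ S.gradeTot n) :
    S.parityHor γ = (-1 : ℂ) ^ n • γ :=
  Subtype.ext (funext fun i => parityLoc_of_mem (hγ i trivial))

end DifferentialStructure

/-! ### From pre-connection forms to covariant derivatives -/

namespace DifferentialStructure

variable {I P B H : Type*} [Ring P] [Algebra ℂ P] [Ring B] [Algebra ℂ B] [Ring H] [HopfAlgebra ℂ H]
variable {E : LocallyTrivialBundle I P B H} {S : DifferentialStructure E}
variable [Fintype I] [DecidableEq I]

lemma isEquivariant_evalHor (i : I) :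
    IsEquivariant S.coactHor (coactLoc (S.ΓB i) S.ΓH) (S.evalHor i) :=
  LinearMap.ext fun γ => (S.coactHor_spec γ i).symm

lemma isEquivariant_evalC (i : I) :
    IsEquivariant S.coactC (coactLoc (S.ΓB i) S.ΓH) (S.evalC i) :=
  LinearMap.ext fun γ => (S.coactC_spec γ i).symm

variable {δ : H →ₗ[ℂ] H ⊗[ℂ] H} {ω : H →ₗ[ℂ] S.gammaC}

lemma isEquivariant_coactC_iff :
    IsEquivariant δ S.coactC ω ↔
      ∀ i, IsEquivariant δ (coactLoc (S.ΓB i) S.ΓH) (S.evalC i ∘ₗ ω) := by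
  refine ⟨fun hω i => (isEquivariant_evalC i).comp hω, fun hω => LinearMap.ext fun h =>
    eq_of_rTensor_eq (f := S.evalC) (fun _ hv => Subtype.ext (funext hv)) fun i => ?_⟩
  rw [LinearMap.comp_apply, LinearMap.comp_apply, ← LinearMap.rTensor_comp_apply, ← (hω i).apply]
  exact S.coactC_spec (ω h) i

lemma isLeftPreConnectionForm_iff :
    S.IsLeftPreConnectionForm ω ↔
      ∀ i, IsFibreDeriv (S.ΓB i) S.ΓH (leftFibreDeriv (S.evalC i ∘ₗ ω)) := by
  simp only [isFibreDeriv_leftFibreDeriv_iff]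
  constructor
  · exact fun hω i => ⟨fun h => hω.degree h i trivial, congrFun (congrArg Subtype.val hω.map_one) i,
      isEquivariant_coactC_iff.1 (LinearMap.ext hω.covariant) i, LinearMap.ext (hω.vertical i)⟩
  · exact fun hω => ⟨fun h i _ => (hω i).1 h, Subtype.ext (funext fun i => (hω i).2.1),
      (isEquivariant_coactC_iff.2 fun i => (hω i).2.2.1).apply,
      fun i => LinearMap.congr_fun (hω i).2.2.2⟩

lemma isRightPreConnectionForm_iff
    {hS : Function.Bijective (HopfAlgebra.antipode ℂ : H →ₗ[ℂ] H)} :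
    S.IsRightPreConnectionForm hS ω ↔
      ∀ i, IsFibreDeriv (S.ΓB i) S.ΓH (rightFibreDeriv (S.evalC i ∘ₗ ω)) := by
  simp only [isFibreDeriv_rightFibreDeriv_iff hS]
  constructor
  · exact fun hω i => ⟨fun h => hω.degree h i trivial, congrFun (congrArg Subtype.val hω.map_one) i,
      isEquivariant_coactC_iff.1 (LinearMap.ext hω.covariant) i, LinearMap.ext (hω.vertical i)⟩
  · exact fun hω => ⟨fun h i _ => (hω i).1 h, Subtype.ext (funext fun i => (hω i).2.1),
      (isEquivariant_coactC_iff.2 fun i => (hω i).2.2.1).apply,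
      fun i => LinearMap.congr_fun (hω i).2.2.2⟩

variable (ω)

lemma convL_apply (γ : S.hor) (i : I) :
    S.convL ω γ i = conv S.coactHor (S.evalHor i) (S.evalC i ∘ₗ ω) γ :=
  LinearMap.congr_fun (algHom_comp_conv (Pi.evalAlgHom ℂ S.Loc i) S.hor.val.toLinearMap
    (S.gammaC.val.toLinearMap ∘ₗ ω)) γ

lemma convR_apply (γ : S.hor) (i : I) :
    S.convR ω γ i = convOp S.coactHor (S.evalHor i) (S.evalC i ∘ₗ ω) γ :=
  LinearMap.congr_fun (algHom_comp_convOp (Pi.evalAlgHom ℂ S.Loc i) S.hor.val.toLinearMap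
    (S.gammaC.val.toLinearMap ∘ₗ ω)) γ

lemma conv_evalHor_apply (i : I) (ω : H →ₗ[ℂ] S.Loc i) (γ : S.hor) :
    conv S.coactHor (S.evalHor i) ω γ =
      conv (coactLoc (S.ΓB i) S.ΓH) LinearMap.id ω (γ.1 i) :=
  (LinearMap.congr_fun ((isEquivariant_evalHor i).conv_comp LinearMap.id ω) γ).symm

lemma convOp_evalHor_apply (i : I) (ω : H →ₗ[ℂ] S.Loc i) (γ : S.hor) :
    convOp S.coactHor (S.evalHor i) ω γ =
      convOp (coactLoc (S.ΓB i) S.ΓH) LinearMap.id ω (γ.1 i) :=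
  (LinearMap.congr_fun ((isEquivariant_evalHor i).convOp_comp LinearMap.id ω) γ).symm

lemma convL_mem_gammaC (γ : S.hor) : S.convL ω γ ∈ S.gammaC :=
  conv_apply_mem (X := ⊤) (U := Subalgebra.toSubmodule S.gammaC)
    (LinearMap.rTensor_surjective H Submodule.topEquiv.surjective _)
    fun v _ h => S.gammaC.mul_mem v.2.1 (ω h).2

lemma convR_mem_gammaC (γ : S.hor) : S.convR ω γ ∈ S.gammaC :=
  convOp_apply_mem (X := ⊤) (U := Subalgebra.toSubmodule S.gammaC)
    (LinearMap.rTensor_surjective H Submodule.topEquiv.surjective _)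
    fun v _ h => S.gammaC.mul_mem (ω h).2 v.2.1

/-- The operator `γ ↦ dγ + (-1)^n ∑ γ₀ω(γ₁)`, `γ` of degree `n`, on horizontal forms. -/
def leftDerivTot : S.hor →ₗ[ℂ] S.Tot :=
  S.dTot ∘ₗ S.hor.val.toLinearMap + S.convL ω ∘ₗ S.parityHor

/-- The operator `γ ↦ dγ + ∑ ω(γ₁)γ₀` on horizontal forms. -/
def rightDerivTot : S.hor →ₗ[ℂ] S.Tot := S.dTot ∘ₗ S.hor.val.toLinearMap + S.convR ω

lemma leftDerivTot_apply (γ : S.hor) (i : I) :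
    leftDerivTot ω γ i = leftDerivLoc (S.evalC i ∘ₗ ω) (γ.1 i) :=
  congrArg (S.dTot γ.1 i + ·) ((convL_apply ω _ i).trans (conv_evalHor_apply i _ _))

lemma rightDerivTot_apply (γ : S.hor) (i : I) :
    rightDerivTot ω γ i = rightDerivLoc (S.evalC i ∘ₗ ω) (γ.1 i) :=
  congrArg (S.dTot γ.1 i + ·) ((convR_apply ω _ i).trans (convOp_evalHor_apply i _ _))

lemma leftDerivTot_of_mem {n : ℕ} {γ : S.hor} (hγ : γ.1 ∈ S.gradeTot n) :
    leftDerivTot ω γ = S.dTot γ.1 + (-1 : ℂ) ^ n • S.convL ω γ := by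
  rw [leftDerivTot, LinearMap.add_apply, LinearMap.comp_apply, LinearMap.comp_apply,
    parityHor_of_mem S hγ, map_smul]
  rfl

variable {ω}

lemma isCovariantOperator_of_local {D : S.hor →ₗ[ℂ] S.hor} {T : ∀ i, S.Loc i →ₗ[ℂ] S.Loc i}
    (hD : ∀ γ i, (D γ).1 i = T i (γ.1 i))
    (degree : ∀ n i x, x ∈ skewGr (S.ΓB i) S.ΓH.toDifferentialCalculus n →
      T i x ∈ skewGr (S.ΓB i) S.ΓH.toDifferentialCalculus (n + 1))
    (map_one : ∀ i, T i 1 = 0)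
    (covariant : ∀ i x, x ∈ horLoc (S.ΓB i) S.ΓH.toDifferentialCalculus →
      coactLoc (S.ΓB i) S.ΓH (T i x) = LinearMap.rTensor H (T i) (coactLoc (S.ΓB i) S.ΓH x)) :
    S.IsCovariantOperator D where
  degree n γ hγ i _ := (hD γ i).symm ▸ degree n i _ (hγ i trivial)
  map_one := Subtype.ext (funext fun i => (hD 1 i).trans (map_one i))
  covariant γ := by
    refine eq_of_rTensor_eq (f := S.evalHor) (fun _ hv => Subtype.ext (funext hv)) fun i => ?_
    have h : S.evalHor i ∘ₗ D = T i ∘ₗ S.evalHor i := LinearMap.ext fun γ => hD γ i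
    rw [← LinearMap.rTensor_comp_apply, h, LinearMap.rTensor_comp_apply, S.coactHor_spec,
      S.coactHor_spec, hD, covariant i _ (γ.2.2 i trivial)]
  map_ker i γ hγ := by rw [hD, hγ, map_zero]

/-- The left covariant derivative of a left pre-connection form. -/
def IsLeftPreConnectionForm.deriv (hω : S.IsLeftPreConnectionForm ω) : S.hor →ₗ[ℂ] S.hor :=
  LinearMap.codRestrict (Subalgebra.toSubmodule S.hor) (leftDerivTot ω) fun γ =>
    ⟨add_mem (S.dTot_mem γ.2.1) (convL_mem_gammaC ω _), fun i _ =>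
      (leftDerivTot_apply ω γ i).symm ▸ leftDerivLoc_mem_horLoc
        (isLeftPreConnectionForm_iff.1 hω i).horizontal (γ.2.2 i trivial)⟩

/-- The right covariant derivative of a right pre-connection form. -/
def IsRightPreConnectionForm.deriv
    {hS : Function.Bijective (HopfAlgebra.antipode ℂ : H →ₗ[ℂ] H)}
    (hω : S.IsRightPreConnectionForm hS ω) : S.hor →ₗ[ℂ] S.hor :=
  LinearMap.codRestrict (Subalgebra.toSubmodule S.hor) (rightDerivTot ω) fun γ =>
    ⟨add_mem (S.dTot_mem γ.2.1) (convR_mem_gammaC ω _), fun i _ =>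
      (rightDerivTot_apply ω γ i).symm ▸ rightDerivLoc_mem_horLoc
        (isRightPreConnectionForm_iff.1 hω i).horizontal (γ.2.2 i trivial)⟩

lemma IsLeftPreConnectionForm.isLeftCovariantDerivative (hω : S.IsLeftPreConnectionForm ω) :
    S.IsLeftCovariantDerivative hω.deriv where
  __ := isCovariantOperator_of_local (leftDerivTot_apply ω)
    (fun _ i _ => leftDerivLoc_mem_skewGr fun h => hω.degree h i trivial)
    (fun i => leftDerivLoc_one (congrFun (congrArg Subtype.val hω.map_one) i))
    fun i _ => coactLoc_leftDerivLoc (isEquivariant_coactC_iff.1 (LinearMap.ext hω.covariant) i)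
  leibniz n ρ α hρ := funext fun i => by
    refine (leftDerivTot_apply ω _ i).trans
      ((leftDerivLoc_inl_mul (hρ i trivial) (α.2.2 i trivial)).trans ?_)
    rw [← skewD_inl, ← leftDerivTot_apply]
    rfl

lemma IsRightPreConnectionForm.isRightCovariantDerivative
    {hS : Function.Bijective (HopfAlgebra.antipode ℂ : H →ₗ[ℂ] H)}
    (hω : S.IsRightPreConnectionForm hS ω) : S.IsRightCovariantDerivative hω.deriv where
  __ := isCovariantOperator_of_local (rightDerivTot_apply ω)
    (fun _ i _ => rightDerivLoc_mem_skewGr fun h => hω.degree h i trivial)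
    (fun i => rightDerivLoc_one (congrFun (congrArg Subtype.val hω.map_one) i))
    fun i _ => coactLoc_rightDerivLoc (isEquivariant_coactC_iff.1 (LinearMap.ext hω.covariant) i)
  leibniz n ρ α hα := funext fun i => by
    refine (rightDerivTot_apply ω _ i).trans
      ((rightDerivLoc_mul_inl (ρ.1 i) (α.2.2 i trivial)).trans ?_)
    rw [← skewD_inl, ← rightDerivTot_apply, parityLoc_of_mem (hα i trivial), smul_mul_assoc]
    rfl

end DifferentialStructure

/-! ### From covariant derivatives to pre-connection forms -/

namespace DifferentialStructure

variable {I P B H : Type*} [Ring P] [Algebra ℂ P] [Ring B] [Algebra ℂ B] [Ring H] [HopfAlgebra ℂ H]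
variable {E : LocallyTrivialBundle I P B H} {S : DifferentialStructure E}
variable {D : S.hor →ₗ[ℂ] S.hor}

variable (S D) in
/-- The values of `D` on the elements `1 ⊗ h` of the `i`-th trivialization. -/
def fibVal (i : I) : H →ₗ[ℂ] S.Loc i := S.evalHor i ∘ₗ D ∘ₗ S.fibLift i

variable [Fintype I] [DecidableEq I]

namespace IsCovariantOperator

variable (hD : S.IsCovariantOperator D)
include hD

lemma apply_eq_of_eq {i : I} {γ γ' : S.hor} (h : γ.1 i = γ'.1 i) : (D γ).1 i = (D γ').1 i := by
  have h' := hD.map_ker i (γ - γ') (sub_eq_zero.2 h)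
  rw [map_sub] at h'
  exact sub_eq_zero.1 h'

lemma apply_eq_of_local {i : I} {T : S.Loc i →ₗ[ℂ] S.Loc i}
    (hT : ∀ n a h, a ∈ (S.ΓB i).gr n → ∃ γ : S.hor,
      γ.1 i = S.inlAt i a * S.fibAt i h ∧ (D γ).1 i = T (S.inlAt i a * S.fibAt i h)) (γ : S.hor) :
    (D γ).1 i = T (γ.1 i) := by
  suffices ∃ γ' : S.hor, γ'.1 i = γ.1 i ∧ (D γ').1 i = T (γ.1 i) from
    have ⟨_, hγ, hT⟩ := this
    (hD.apply_eq_of_eq hγ).symm.trans hT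
  have hγ := γ.2.2 i trivial
  generalize γ.1 i = x at hγ
  induction hγ using horLoc_induction with
  | zero => exact ⟨0, rfl, by simp⟩
  | add x y _ _ hx hy =>
    obtain ⟨γ, rfl, h⟩ := hx
    obtain ⟨γ', rfl, h'⟩ := hy
    exact ⟨γ + γ', rfl, by rw [map_add, map_add, ← h, ← h']; rfl⟩
  | mul n a h ha _ => exact hT n a h ha

lemma isEquivariant_fibVal (i : I) :
    IsEquivariant Coalgebra.comul (coactLoc (S.ΓB i) S.ΓH) (S.fibVal D i) := by
  refine LinearMap.ext fun h => ?_
  have hlift : S.evalHor i ∘ₗ S.fibLift i = (S.fibAt i).toLinearMap :=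
    LinearMap.ext (S.fibLift_apply_self i)
  have hcoact : LinearMap.rTensor H (S.evalHor i) (S.coactHor (S.fibLift i h)) =
      LinearMap.rTensor H (S.evalHor i)
        (LinearMap.rTensor H (S.fibLift i) (Coalgebra.comul h)) := by
    rw [S.coactHor_spec, S.fibLift_apply_self, ← LinearMap.rTensor_comp_apply, hlift]
    exact isEquivariant_fib.apply h
  have hcoactD := rTensor_eq_of_ker_le (g := S.evalHor i ∘ₗ D) (hD.map_ker i) hcoact
  rw [LinearMap.rTensor_comp_apply, hD.covariant, S.coactHor_spec] at hcoactD
  rw [LinearMap.comp_apply, LinearMap.comp_apply, fibVal, ← LinearMap.comp_assoc,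
    LinearMap.rTensor_comp_apply]
  exact hcoactD

lemma isFibreDeriv_fibVal (i : I) : IsFibreDeriv (S.ΓB i) S.ΓH (S.fibVal D i) where
  degree h := hD.degree 0 _ (S.fibLift_mem_gradeTot i h) i trivial
  map_one := (hD.apply_eq_of_eq (γ' := 1)
    ((S.fibLift_apply_self i 1).trans (_root_.map_one (S.fibAt i)))).trans
      (congrFun (congrArg Subtype.val hD.map_one) i)
  equivariant := hD.isEquivariant_fibVal i
  horizontal _ := (D _).2.2 i trivial

end IsCovariantOperator

variable (S D) in
/-- The local form over the `i`-th trivialization which is to be the `i`-th component of the left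
pre-connection form of `D`. -/
def leftLocalForm (i : I) : H →ₗ[ℂ] S.Loc i :=
  (leftFibreEquiv (S.ΓB i) S.ΓH).symm (S.fibVal D i)

variable (S D) in
/-- The local form over the `i`-th trivialization which is to be the `i`-th component of the right
pre-connection form of `D`. -/
def rightLocalForm (hS : Function.Bijective (HopfAlgebra.antipode ℂ : H →ₗ[ℂ] H)) (i : I) :
    H →ₗ[ℂ] S.Loc i :=
  (rightFibreEquiv (S.ΓB i) S.ΓH hS).symm (S.fibVal D i)

namespace IsLeftCovariantDerivative

variable (hD : S.IsLeftCovariantDerivative D)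
include hD

lemma apply_eq (γ : S.hor) (i : I) : (D γ).1 i = leftDerivLoc (S.leftLocalForm D i) (γ.1 i) := by
  refine hD.apply_eq_of_local (fun n a h ha => ?_) γ
  obtain ⟨ρ, hρ, rfl⟩ := S.exists_base_form i ha
  refine ⟨S.iotaC ρ * S.fibLift i h, congrArg (S.inlAt i (ρ.1 i) * ·) (S.fibLift_apply_self i h),
    (congrFun (hD.leibniz n ρ _ hρ) i).trans ?_⟩
  rw [leftDerivLoc_inl_mul_fib, leftLocalForm, leftFibreDeriv_symm, (S.ΓB i).parity_of_mem ha,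
    map_smul, smul_mul_assoc, ← skewD_inl, ← S.fibLift_apply_self]
  rfl

lemma conv_leftLocalForm {γ : S.hor} (hγ : γ.1 ∈ S.gradeTot 0) (i : I) :
    conv S.coactHor (S.evalHor i) (S.leftLocalForm D i) γ = ((D γ).1 - S.dTot γ.1) i := by
  rw [Pi.sub_apply, hD.apply_eq, leftDerivLoc, LinearMap.add_apply, LinearMap.comp_apply,
    parityLoc_of_mem (hγ i trivial), pow_zero, one_smul, conv_evalHor_apply]
  exact (add_sub_cancel_left _ _).symm

lemma compatible_leftLocalForm (h : H) (i j : I) :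
    Compatible S.χΓ i j (S.leftLocalForm D i h) (S.leftLocalForm D j h) := by
  refine compatible_of_conv (f₂ := S.evalHor j) S.χΓ_surjective (fun γ => γ.2.1 i j)
    (isEquivariant_evalHor i) isEquivariant_fib
    (fun h => ⟨S.fibLift i h, S.fibLift_apply_self i h, ?_⟩) h
  rw [hD.conv_leftLocalForm (S.fibLift_mem_gradeTot i h),
    hD.conv_leftLocalForm (S.fibLift_mem_gradeTot i h)]
  exact sub_mem (D _).2.1 (S.dTot_mem (S.fibLift i h).2.1) i j

/-- The left pre-connection form of a left covariant derivative. -/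
def form : H →ₗ[ℂ] S.gammaC :=
  LinearMap.codRestrict (Subalgebra.toSubmodule S.gammaC) (LinearMap.pi (S.leftLocalForm D))
    hD.compatible_leftLocalForm

lemma isLeftPreConnectionForm : S.IsLeftPreConnectionForm hD.form :=
  isLeftPreConnectionForm_iff.2 fun i =>
    (leftFibreDeriv_symm (S.fibVal D i)).symm.subst (motive := IsFibreDeriv _ _)
      (hD.isFibreDeriv_fibVal i)

lemma eq_leftDerivTot (γ : S.hor) : (D γ).1 = leftDerivTot hD.form γ :=
  funext fun i => (hD.apply_eq γ i).trans (leftDerivTot_apply hD.form γ i).symm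

end IsLeftCovariantDerivative

namespace IsRightCovariantDerivative

variable (hS : Function.Bijective (HopfAlgebra.antipode ℂ : H →ₗ[ℂ] H))
  (hD : S.IsRightCovariantDerivative D)
include hD

lemma apply_eq (γ : S.hor) (i : I) :
    (D γ).1 i = rightDerivLoc (S.rightLocalForm D hS i) (γ.1 i) := by
  refine hD.apply_eq_of_local (fun n a h ha => ?_) γ
  obtain ⟨ρ, -, rfl⟩ := S.exists_base_form i ha
  refine ⟨S.fibLift i h * S.iotaC ρ,
    (congrArg (· * S.inlAt i (ρ.1 i)) (S.fibLift_apply_self i h)).trans (fib_mul_inl _ h),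
    (congrFun (hD.leibniz 0 ρ _ (S.fibLift_mem_gradeTot i h)) i).trans ?_⟩
  rw [rightDerivLoc_inl_mul_fib, rightLocalForm, rightFibreDeriv_symm, ← fib_mul_inl, add_comm,
    pow_zero, one_smul, ← skewD_inl, ← S.fibLift_apply_self]
  rfl

lemma convOp_rightLocalForm (γ : S.hor) (i : I) :
    convOp S.coactHor (S.evalHor i) (S.rightLocalForm D hS i) γ = ((D γ).1 - S.dTot γ.1) i := by
  rw [Pi.sub_apply, hD.apply_eq hS, rightDerivLoc, LinearMap.add_apply, convOp_evalHor_apply]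
  exact (add_sub_cancel_left _ _).symm

lemma compatible_rightLocalForm (h : H) (i j : I) :
    Compatible S.χΓ i j (S.rightLocalForm D hS i h) (S.rightLocalForm D hS j h) := by
  refine compatible_of_convOp (f₂ := S.evalHor j) hS S.χΓ_surjective (fun γ => γ.2.1 i j)
    (isEquivariant_evalHor i) isEquivariant_fib
    (fun h => ⟨S.fibLift i h, S.fibLift_apply_self i h, ?_⟩) h
  rw [hD.convOp_rightLocalForm, hD.convOp_rightLocalForm]
  exact sub_mem (D _).2.1 (S.dTot_mem (S.fibLift i h).2.1) i j

/-- The right pre-connection form of a right covariant derivative. -/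
def form : H →ₗ[ℂ] S.gammaC :=
  LinearMap.codRestrict (Subalgebra.toSubmodule S.gammaC) (LinearMap.pi (S.rightLocalForm D hS))
    (hD.compatible_rightLocalForm hS)

lemma isRightPreConnectionForm : S.IsRightPreConnectionForm hS (hD.form hS) :=
  isRightPreConnectionForm_iff.2 fun i =>
    (rightFibreDeriv_symm hS (S.fibVal D i)).symm.subst (motive := IsFibreDeriv _ _)
      (hD.isFibreDeriv_fibVal i)

lemma eq_rightDerivTot (γ : S.hor) : (D γ).1 = rightDerivTot (hD.form hS) γ :=
  funext fun i => (hD.apply_eq hS γ i).trans (rightDerivTot_apply (hD.form hS) γ i).symm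

end IsRightCovariantDerivative

/-! ### The correspondence -/

variable {ω : H →ₗ[ℂ] S.gammaC}

lemma leftLocalForm_deriv (hω : S.IsLeftPreConnectionForm ω) (i : I) :
    S.leftLocalForm hω.deriv i = S.evalC i ∘ₗ ω := by
  refine (leftFibreEquiv _ _).symm_apply_eq.2 (LinearMap.ext fun h => ?_)
  refine (leftDerivTot_apply ω _ i).trans ?_
  rw [S.fibLift_apply_self, leftDerivLoc_fib]
  rfl

lemma rightLocalForm_deriv {hS : Function.Bijective (HopfAlgebra.antipode ℂ : H →ₗ[ℂ] H)}
    (hω : S.IsRightPreConnectionForm hS ω) (i : I) :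
    S.rightLocalForm hω.deriv hS i = S.evalC i ∘ₗ ω := by
  refine (rightFibreEquiv _ _ hS).symm_apply_eq.2 (LinearMap.ext fun h => ?_)
  refine (rightDerivTot_apply ω _ i).trans ?_
  rw [S.fibLift_apply_self, rightDerivLoc_fib]
  rfl

variable (S) in
/-- The bijection between left covariant derivatives and left pre-connection forms. -/
def leftEquiv :
    {D : S.hor →ₗ[ℂ] S.hor // S.IsLeftCovariantDerivative D} ≃
      {ω : H →ₗ[ℂ] S.gammaC // S.IsLeftPreConnectionForm ω} where
  toFun D := ⟨D.2.form, D.2.isLeftPreConnectionForm⟩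
  invFun ω := ⟨ω.2.deriv, ω.2.isLeftCovariantDerivative⟩
  left_inv D := Subtype.ext (LinearMap.ext fun γ => Subtype.ext (D.2.eq_leftDerivTot γ).symm)
  right_inv ω := Subtype.ext (LinearMap.ext fun h => Subtype.ext (funext fun i =>
    LinearMap.congr_fun (leftLocalForm_deriv ω.2 i) h))

variable (S) in
/-- The bijection between right covariant derivatives and right pre-connection forms. -/
def rightEquiv (hS : Function.Bijective (HopfAlgebra.antipode ℂ : H →ₗ[ℂ] H)) :
    {D : S.hor →ₗ[ℂ] S.hor // S.IsRightCovariantDerivative D} ≃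
      {ω : H →ₗ[ℂ] S.gammaC // S.IsRightPreConnectionForm hS ω} where
  toFun D := ⟨D.2.form hS, D.2.isRightPreConnectionForm hS⟩
  invFun ω := ⟨ω.2.deriv, ω.2.isRightCovariantDerivative⟩
  left_inv D := Subtype.ext (LinearMap.ext fun γ => Subtype.ext (D.2.eq_rightDerivTot hS γ).symm)
  right_inv ω := Subtype.ext (LinearMap.ext fun h => Subtype.ext (funext fun i =>
    LinearMap.congr_fun (rightLocalForm_deriv ω.2 i) h))

end DifferentialStructure

end QPB

end

theorem proposition14 {I P B H : Type*} [Fintype I] [DecidableEq I]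
    [Ring P] [Algebra ℂ P] [Ring B] [Algebra ℂ B] [Ring H] [HopfAlgebra ℂ H]
    (hS : Function.Bijective (HopfAlgebra.antipode ℂ : H →ₗ[ℂ] H))
    (E : QPB.LocallyTrivialBundle I P B H) (S : QPB.DifferentialStructure E) :
    (∃ Φ : {D : S.hor →ₗ[ℂ] S.hor // S.IsLeftCovariantDerivative D} ≃
        {ω : H →ₗ[ℂ] S.gammaC // S.IsLeftPreConnectionForm ω},
      ∀ D (n : ℕ) (γ : S.hor), γ.1 ∈ S.gradeTot n →
        (D.1 γ).1 = S.dTot γ.1 + (-1 : ℂ) ^ n • S.convL (Φ D).1 γ) ∧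
    (∃ Φ : {D : S.hor →ₗ[ℂ] S.hor // S.IsRightCovariantDerivative D} ≃
        {ω : H →ₗ[ℂ] S.gammaC // S.IsRightPreConnectionForm hS ω},
      ∀ D (γ : S.hor), (D.1 γ).1 = S.dTot γ.1 + S.convR (Φ D).1 γ) := by
  refine ⟨⟨S.leftEquiv, fun D n γ hγ => ?_⟩, ⟨S.rightEquiv hS, fun D γ => ?_⟩⟩
  · exact (D.2.eq_leftDerivTot γ).trans
      (QPB.DifferentialStructure.leftDerivTot_of_mem D.2.form hγ)
  · exact D.2.eq_rightDerivTot hS γ
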